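/- Let $d\ge 2$ and let $\Omega\subset\mathbb R^d$ be a bounded domain with Lipschitz boundary $\Gamma=\Gamma_0\cup\Gamma_1$, where $\Gamma_0,\Gamma_1$ are relatively open subsets of $\Gamma$ with $\overline{\Gamma_0}\cap\overline{\Gamma_1}=\emptyset$ and $\Gamma_1\neq\emptyset$. Let $a>0$, $b\in\mathbb R\setminus\{0\}$, $\gamma>0$, $\alpha\in(0,1)$, $\eta\ge 0$, and put $$\mu(\xi)=|\xi|^{\frac{2\alpha-d}{2}},\qquad \kappa=\kappa(\alpha,d)=\frac{2\sin(\alpha\pi)\,\Gamma(\frac d2+1)}{d\,\pi^{\frac d2+1}} .$$ Let $H^1_{\Gamma_0}(\Omega)=\{u\in H^1(\Omega): u=0 \text{ on }\Gamma_0\}$ (all spaces are complex) and $$\mathcal H=H^1_{\Gamma_0}(\Omega)\times L^2(\Omega)\times H^1_0(\Omega)\times L^2(\Omega)\times L^2(\Gamma_1\times\mathbb R^d),$$ $$\|(u,v,y,z,\omega)\|_{\mathcal H}^2=\int_\Omega\left(|v|^2+|\nabla u|^2+|z|^2+a|\nabla y|^2\right)dx+\gamma\kappa\int_{\Gamma_1}\int_{\mathbb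 R^d}|\omega(x,\xi)|^2\,d\xi\,d\Gamma .$$ Let $\mathcal A$ be the unbounded operator in $\mathcal H$ whose domain $D(\mathcal A)$ consists of all $U=(u,v,y,z,\omega)\in\mathcal H$ such that $\Delta u\in L^2(\Omega)$, $y\in H^2(\Omega)\cap H^1_0(\Omega)$, $v\in H^1_{\Gamma_0}(\Omega)$, $z\in H^1_0(\Omega)$, $-(|\xi|^2+\eta)\omega+v|_{\Gamma_1}\mu(\xi)\in L^2(\Gamma_1\times\mathbb R^d)$, $|\xi|\omega\in L^2(\Gamma_1\times\mathbb R^d)$ and $\frac{\partial u}{\partial\nu}+\gamma\kappa\int_{\mathbb R^d}\mu(\xi)\omega(\cdot,\xi)\,d\xi=0$ on $\Gamma_1$ (in the weak sense given by Green's formula), with $$\mathcal A(u,v,y,z,\omega)=\left(v,\ \Delta u-bz,\ z,\ a\Delta y+bv,\ -(|\xi|^2+\eta)\omega+v|_{\Gamma_1}\mu(\xi)\right).$$ Assume that $\eta=0$. Then $-\mathcal A$ is not invertible (it is not a bijection of $D(\mathcal A)$ onto $\mathcal H$ with bounded inverse), and consequently $0\in\sigma(\mathcal A)$. Moreover, there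 exist $\varphi\in H^1_{\Gamma_0}(\Omega)$ whose trace $\varphi|_{\Gamma_1}$ does not vanish almost everywhere on $\Gamma_1$, and for every such $\varphi$ the function $(x,\xi)\mapsto|\xi|^{\frac{2\alpha-d-4}{2}}\varphi|_{\Gamma_1}(x)$ is not in $L^2(\Gamma_1\times\mathbb R^d)$ and there is no $U\in D(\mathcal A)$ with $-\mathcal A U=(\varphi,0,0,0,0)$. -/

import Mathlib

open MeasureTheory Filter Topology
open scoped ContDiff ENNReal

noncomputable section

namespace CoupledWave

/-! ## Domains with Lipschitz boundary -/

/-- The Euclidean space `ℝ^d`. -/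
abbrev E (d : ℕ) : Type := EuclideanSpace ℝ (Fin d)

variable {d : ℕ}

/-- `Ω` has a Lipschitz boundary: near each boundary point there is a unit direction `e` and a
Lipschitz function `h` of the component of `y` orthogonal to `e`, such that `Ω` is locally the set
of points lying strictly above the graph of `h` in direction `e`. -/
def HasLipschitzBoundary (Ω : Set (E d)) : Prop :=
  ∀ x ∈ frontier Ω, ∃ (e : E d) (h : E d → ℝ) (K : NNReal) (r : ℝ),
    ‖e‖ = 1 ∧ LipschitzWith K h ∧ 0 < r ∧
      ∀ y ∈ Metric.ball x r, (y ∈ Ω ↔ h (y - inner ℝ e y • e) < inner ℝ e y)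

/-- The geometric setting: `Ω` is a bounded domain with Lipschitz boundary
`Γ = Γ₀ ∪ Γ₁`, where `Γ₀`, `Γ₁` are relatively open in `Γ`, have disjoint closures, and `Γ₁` is
non-empty. -/
structure IsAdmissible (Ω Γ₀ Γ₁ : Set (E d)) : Prop where
  isOpen : IsOpen Ω
  isConnected : IsConnected Ω
  isBounded : Bornology.IsBounded Ω
  lipschitz : HasLipschitzBoundary Ω
  union : Γ₀ ∪ Γ₁ = frontier Ω
  relOpen₀ : ∃ O : Set (E d), IsOpen O ∧ Γ₀ = O ∩ frontier Ω
  relOpen₁ : ∃ O : Set (E d), IsOpen O ∧ Γ₁ = O ∩ frontier Ω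
  disjoint : Disjoint (closure Γ₀) (closure Γ₁)
  nonempty₁ : Γ₁.Nonempty

/-- Surface measure on `Γ = ∂Ω`: the `(d-1)`-dimensional Hausdorff measure (normalised as in
Euclidean geometry) restricted to `∂Ω`. -/
def surf (Ω : Set (E d)) : Measure (E d) :=
  (Measure.euclideanHausdorffMeasure (d - 1) : Measure (E d)).restrict (frontier Ω)

/-- The measure `dΓ dξ` on `Γ₁ × ℝ^d`. -/
def surfProd (Ω Γ₁ : Set (E d)) : Measure (E d × E d) :=
  ((surf Ω).restrict Γ₁).prod volume

/-- `L²(Ω)`, complex valued. -/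
abbrev L2 (Ω : Set (E d)) : Type := Lp ℂ 2 ((volume : Measure (E d)).restrict Ω)

/-- `L²(Γ)`. -/
abbrev L2bd (Ω : Set (E d)) : Type := Lp ℂ 2 (surf Ω)

/-- `L²(Γ₁)`. -/
abbrev L2bd₁ (Ω Γ₁ : Set (E d)) : Type := Lp ℂ 2 ((surf Ω).restrict Γ₁)

/-- `L²(Γ₁ × ℝ^d)`. -/
abbrev L2aux (Ω Γ₁ : Set (E d)) : Type := Lp ℂ 2 (surfProd Ω Γ₁)

/-! ## Sobolev spaces -/

/-- The `i`-th classical partial derivative. -/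
def pd {F : Type*} [NormedAddCommGroup F] [NormedSpace ℝ F] (i : Fin d) (φ : E d → F) (x : E d) :
    F :=
  fderiv ℝ φ x (EuclideanSpace.single i 1)

/-- Real test functions on `Ω`. -/
structure IsTest (Ω : Set (E d)) (φ : E d → ℝ) : Prop where
  smooth : ContDiff ℝ ∞ φ
  compact : HasCompactSupport φ
  subset : tsupport φ ⊆ Ω

lemma contDiff_pd {F : Type*} [NormedAddCommGroup F] [NormedSpace ℝ F] (i : Fin d) {φ : E d → F}
    (h : ContDiff ℝ ∞ φ) : ContDiff ℝ ∞ (pd i φ) :=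
  (h.fderiv_right (m := ∞) (by simp)).clm_apply contDiff_const

lemma IsTest.pd {Ω : Set (E d)} {φ : E d → ℝ} (h : IsTest Ω φ) (i : Fin d) :
    IsTest Ω (CoupledWave.pd i φ) where
  smooth := contDiff_pd i h.smooth
  compact := h.compact.fderiv_apply (𝕜 := ℝ) _
  subset := (tsupport_fderiv_apply_subset ℝ _).trans h.subset

/-- A continuous compactly supported weight times an `L²(Ω)` function is integrable. -/
lemma IsTest.integrable_smul {Ω : Set (E d)} {φ : E d → ℝ} (h : IsTest Ω φ) (u : L2 Ω) :
    Integrable (fun x => φ x • u x) (volume.restrict Ω) := by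
  have h1 : MemLp φ 2 ((volume : Measure (E d)).restrict Ω) :=
    (h.smooth.continuous.memLp_of_hasCompactSupport h.compact).restrict Ω
  exact MemLp.integrable_mul (Lp.memLp u) h1.ofReal |>.congr (by
    filter_upwards with x
    simp [mul_comm])

lemma integral_smul_zero {Ω : Set (E d)} (ψ : E d → ℝ) :
    ∫ x in Ω, ψ x • (0 : L2 Ω) x = 0 := by
  apply integral_eq_zero_of_ae
  filter_upwards [Lp.coeFn_zero ℂ 2 ((volume : Measure (E d)).restrict Ω)] with x hx
  rw [hx]
  simp only [Pi.zero_apply, smul_zero]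

lemma integral_smul_add {Ω : Set (E d)} {ψ : E d → ℝ} (hψ : IsTest Ω ψ) (f g : L2 Ω) :
    ∫ x in Ω, ψ x • (f + g) x = (∫ x in Ω, ψ x • f x) + ∫ x in Ω, ψ x • g x := by
  rw [← integral_add (hψ.integrable_smul f) (hψ.integrable_smul g)]
  apply integral_congr_ae
  filter_upwards [Lp.coeFn_add f g] with x hx
  rw [hx, Pi.add_apply, smul_add]

lemma integral_smul_smul {Ω : Set (E d)} (ψ : E d → ℝ) (c : ℂ) (f : L2 Ω) :
    ∫ x in Ω, ψ x • (c • f) x = c * ∫ x in Ω, ψ x • f x := by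
  rw [← integral_const_mul]
  apply integral_congr_ae
  filter_upwards [Lp.coeFn_smul c f] with x hx
  rw [hx, Pi.smul_apply, smul_eq_mul, Complex.real_smul, Complex.real_smul]
  ring

/-- The graph of the weak derivative `∂_i` in `L²(Ω)`. -/
def weakPartialGraph (Ω : Set (E d)) (i : Fin d) : Submodule ℂ (L2 Ω × L2 Ω) where
  carrier := {p | ∀ φ : E d → ℝ, IsTest Ω φ →
    ∫ x in Ω, pd i φ x • p.1 x = - ∫ x in Ω, φ x • p.2 x}
  zero_mem' := by
    intro φ hφ
    simp only [Prod.fst_zero, Prod.snd_zero, integral_smul_zero, neg_zero]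
  add_mem' := by
    intro p q hp hq φ hφ
    have h1 := hp φ hφ
    have h2 := hq φ hφ
    simp only [Prod.fst_add, Prod.snd_add]
    rw [integral_smul_add (hφ.pd i), integral_smul_add hφ, h1, h2]
    ring
  smul_mem' := by
    intro c p hp φ hφ
    have h1 := hp φ hφ
    simp only [Prod.smul_fst, Prod.smul_snd]
    rw [integral_smul_smul, integral_smul_smul, h1]
    ring

/-- An `L²(Ω)` function that integrates to zero against every test function vanishes. -/
lemma eq_zero_of_test {Ω : Set (E d)} (hΩ : IsOpen Ω) (f : L2 Ω)
    (h : ∀ φ : E d → ℝ, IsTest Ω φ → ∫ x in Ω, φ x • f x = 0) : f = 0 := by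
  have hloc : LocallyIntegrable f ((volume : Measure (E d)).restrict Ω) :=
    (Lp.memLp f).locallyIntegrable (by norm_num)
  have h1 := IsOpen.ae_eq_zero_of_integral_contDiff_smul_eq_zero
    (μ := (volume : Measure (E d)).restrict Ω) hΩ (hloc.locallyIntegrableOn Ω)
    (fun g g1 g2 g3 => h g ⟨g1, g2, g3⟩)
  rw [Lp.eq_zero_iff_ae_eq_zero]
  filter_upwards [h1, ae_restrict_mem hΩ.measurableSet] with x hx hxΩ
  simpa using hx hxΩ

/-- Weak derivatives are unique. -/
lemma weakPartialGraph_unique {Ω : Set (E d)} (hΩ : IsOpen Ω) (i : Fin d) (p : L2 Ω × L2 Ω)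
    (hp : p ∈ weakPartialGraph Ω i) (h0 : p.1 = 0) : p.2 = 0 := by
  refine eq_zero_of_test hΩ _ fun φ hφ => ?_
  have h1 := hp φ hφ
  rw [h0, integral_smul_zero] at h1
  exact neg_eq_zero.mp h1.symm

/-- The weak derivative `∂_i` as a partially defined operator in `L²(Ω)`. -/
def weakPartial (Ω : Set (E d)) (i : Fin d) : L2 Ω →ₗ.[ℂ] L2 Ω :=
  (weakPartialGraph Ω i).toLinearPMap

/-- `H¹(Ω)`, as a subspace of `L²(Ω)`. -/
def H1 (Ω : Set (E d)) : Submodule ℂ (L2 Ω) := ⨅ i, (weakPartial Ω i).domain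

/-- The weak derivative `∂_i : H¹(Ω) → L²(Ω)`. -/
def D (Ω : Set (E d)) (i : Fin d) : H1 Ω →ₗ[ℂ] L2 Ω :=
  (weakPartial Ω i).toFun ∘ₗ Submodule.inclusion (iInf_le _ i)

lemma D_spec {Ω : Set (E d)} (hΩ : IsOpen Ω) (i : Fin d) (u : H1 Ω) (φ : E d → ℝ)
    (hφ : IsTest Ω φ) :
    ∫ x in Ω, pd i φ x • (u : L2 Ω) x = - ∫ x in Ω, φ x • D Ω i u x :=
  Submodule.mem_graph_toLinearPMap (fun p hp h0 => weakPartialGraph_unique hΩ i p hp h0)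
    (Submodule.inclusion (iInf_le _ i) u) φ hφ

/-- `H²(Ω)`: functions of `H¹(Ω)` with first order derivatives in `H¹(Ω)`. -/
def H2 (Ω : Set (E d)) : Submodule ℂ (L2 Ω) where
  carrier := {u | ∃ hu : u ∈ H1 Ω, ∀ i, D Ω i ⟨u, hu⟩ ∈ H1 Ω}
  zero_mem' := ⟨zero_mem _, fun i => by
    have : D Ω i ⟨0, zero_mem _⟩ = 0 := map_zero (D Ω i)
    rw [this]; exact zero_mem _⟩
  add_mem' := by
    rintro u v ⟨hu, hu'⟩ ⟨hv, hv'⟩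
    refine ⟨add_mem hu hv, fun i => ?_⟩
    have : D Ω i ⟨u + v, add_mem hu hv⟩ = D Ω i ⟨u, hu⟩ + D Ω i ⟨v, hv⟩ :=
      map_add (D Ω i) ⟨u, hu⟩ ⟨v, hv⟩
    rw [this]; exact add_mem (hu' i) (hv' i)
  smul_mem' := by
    rintro c u ⟨hu, hu'⟩
    refine ⟨Submodule.smul_mem _ c hu, fun i => ?_⟩
    have : D Ω i ⟨c • u, Submodule.smul_mem _ c hu⟩ = c • D Ω i ⟨u, hu⟩ :=
      map_smul (D Ω i) c ⟨u, hu⟩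
    rw [this]; exact Submodule.smul_mem _ c (hu' i)

/-- The sequence of (smooth) functions `φ n` converges to `u` in the norm of `H¹(Ω)`. -/
def TendstoH1 (Ω : Set (E d)) (φ : ℕ → E d → ℂ) (u : H1 Ω) : Prop :=
  Tendsto (fun n => eLpNorm (φ n - ⇑(u : L2 Ω)) 2 (volume.restrict Ω)) atTop (𝓝 0) ∧
  ∀ i, Tendsto (fun n => eLpNorm (pd i (φ n) - ⇑(D Ω i u)) 2 (volume.restrict Ω)) atTop (𝓝 0)

/-- Auxiliary: `L²`-convergence (towards an `L²` class) is additive. -/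
lemma tendsto_eLpNorm_add {μ : Measure (E d)} {φ ψ : ℕ → E d → ℂ} {u v : Lp ℂ 2 μ}
    (hφ : ∀ n, Continuous (φ n)) (hψ : ∀ n, Continuous (ψ n))
    (h1 : Tendsto (fun n => eLpNorm (φ n - ⇑u) 2 μ) atTop (𝓝 0))
    (h2 : Tendsto (fun n => eLpNorm (ψ n - ⇑v) 2 μ) atTop (𝓝 0)) :
    Tendsto (fun n => eLpNorm (φ n + ψ n - ⇑(u + v)) 2 μ) atTop (𝓝 0) := by
  have h3 := h1.add h2
  rw [add_zero] at h3
  refine tendsto_of_tendsto_of_tendsto_of_le_of_le tendsto_const_nhds h3 (fun _ => zero_le) ?_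
  intro n
  have : φ n + ψ n - ⇑(u + v) =ᵐ[μ] (φ n - ⇑u) + (ψ n - ⇑v) := by
    filter_upwards [Lp.coeFn_add u v] with x hx
    simp only [Pi.sub_apply, Pi.add_apply, hx]
    ring
  calc eLpNorm (φ n + ψ n - ⇑(u + v)) 2 μ = eLpNorm ((φ n - ⇑u) + (ψ n - ⇑v)) 2 μ :=
        eLpNorm_congr_ae this
    _ ≤ _ := eLpNorm_add_le ((hφ n).aestronglyMeasurable.sub (Lp.aestronglyMeasurable u))
        ((hψ n).aestronglyMeasurable.sub (Lp.aestronglyMeasurable v)) (by norm_num)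

/-- Auxiliary: `L²`-convergence is homogeneous. -/
lemma tendsto_eLpNorm_smul {μ : Measure (E d)} {φ : ℕ → E d → ℂ} {u : Lp ℂ 2 μ} (c : ℂ)
    (h1 : Tendsto (fun n => eLpNorm (φ n - ⇑u) 2 μ) atTop (𝓝 0)) :
    Tendsto (fun n => eLpNorm (c • φ n - ⇑(c • u)) 2 μ) atTop (𝓝 0) := by
  have h3 : Tendsto (fun n => ‖c‖ₑ * eLpNorm (φ n - ⇑u) 2 μ) atTop (𝓝 0) := by
    simpa using ENNReal.Tendsto.const_mul h1 (Or.inr (by simp))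
  refine h3.congr fun n => ?_
  rw [← eLpNorm_const_smul]
  apply eLpNorm_congr_ae
  filter_upwards [Lp.coeFn_smul c u] with x hx
  simp only [Pi.sub_apply, Pi.smul_apply, hx, smul_sub]

/-- Auxiliary: the constant sequence `0` converges to the class `0`. -/
lemma tendsto_eLpNorm_zero {μ : Measure (E d)} :
    Tendsto (fun _ : ℕ => eLpNorm ((0 : E d → ℂ) - ⇑(0 : Lp ℂ 2 μ)) 2 μ) atTop (𝓝 0) := by
  have : eLpNorm ((0 : E d → ℂ) - ⇑(0 : Lp ℂ 2 μ)) 2 μ = 0 := by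
    rw [← eLpNorm_zero (ε := ℂ) (μ := μ) (p := 2)]
    apply eLpNorm_congr_ae
    filter_upwards [Lp.coeFn_zero ℂ 2 μ] with x hx
    rw [Pi.sub_apply, hx]
    simp
  rw [this]
  exact tendsto_const_nhds

lemma pd_add {i : Fin d} {φ ψ : E d → ℂ} (hφ : ContDiff ℝ ∞ φ) (hψ : ContDiff ℝ ∞ ψ) :
    pd i (φ + ψ) = pd i φ + pd i ψ := by
  ext x
  simp only [pd, Pi.add_apply]
  rw [fderiv_add (hφ.differentiable (by simp) x) (hψ.differentiable (by simp) x)]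
  rfl

lemma pd_smul {i : Fin d} {φ : E d → ℂ} (hφ : ContDiff ℝ ∞ φ) (c : ℂ) :
    pd i (c • φ) = c • pd i φ := by
  ext x
  simp only [pd, Pi.smul_apply]
  rw [fderiv_const_smul (hφ.differentiable (by simp) x)]
  rfl

lemma pd_zero {i : Fin d} : pd i (0 : E d → ℂ) = 0 := by
  ext x
  simp [pd]

lemma TendstoH1.add {Ω : Set (E d)} {φ ψ : ℕ → E d → ℂ} {u v : H1 Ω}
    (hφ : ∀ n, ContDiff ℝ ∞ (φ n)) (hψ : ∀ n, ContDiff ℝ ∞ (ψ n))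
    (h1 : TendstoH1 Ω φ u) (h2 : TendstoH1 Ω ψ v) :
    TendstoH1 Ω (fun n => φ n + ψ n) (u + v) := by
  refine ⟨tendsto_eLpNorm_add (fun n => (hφ n).continuous) (fun n => (hψ n).continuous) h1.1 h2.1,
    fun i => ?_⟩
  have := tendsto_eLpNorm_add (fun n => (contDiff_pd i (hφ n)).continuous)
    (fun n => (contDiff_pd i (hψ n)).continuous) (h1.2 i) (h2.2 i)
  simpa only [pd_add (hφ _) (hψ _), map_add] using this

lemma TendstoH1.smul {Ω : Set (E d)} {φ : ℕ → E d → ℂ} {u : H1 Ω} (c : ℂ)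
    (hφ : ∀ n, ContDiff ℝ ∞ (φ n)) (h1 : TendstoH1 Ω φ u) :
    TendstoH1 Ω (fun n => c • φ n) (c • u) := by
  refine ⟨tendsto_eLpNorm_smul c h1.1, fun i => ?_⟩
  have := tendsto_eLpNorm_smul c (h1.2 i)
  simpa only [pd_smul (hφ _), map_smul] using this

lemma TendstoH1.zero {Ω : Set (E d)} : TendstoH1 Ω (fun _ => 0) (0 : H1 Ω) := by
  refine ⟨tendsto_eLpNorm_zero, fun i => ?_⟩
  simp only [pd_zero, map_zero]
  exact tendsto_eLpNorm_zero

/-- The graph of the trace operator: the closure in `H¹(Ω) × L²(Γ)` of the set of pairs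
`(φ|_Ω, φ|_Γ)` with `φ` smooth on `ℝ^d`. -/
def traceGraph (Ω : Set (E d)) : Submodule ℂ (L2 Ω × L2bd Ω) where
  carrier := {p | ∃ hu : p.1 ∈ H1 Ω, ∃ φ : ℕ → E d → ℂ, (∀ n, ContDiff ℝ ∞ (φ n)) ∧
    TendstoH1 Ω φ ⟨p.1, hu⟩ ∧
    Tendsto (fun n => eLpNorm (φ n - ⇑p.2) 2 (surf Ω)) atTop (𝓝 0)}
  zero_mem' := by
    refine ⟨zero_mem _, fun _ => 0, fun _ => contDiff_const, ?_, ?_⟩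
    · exact TendstoH1.zero
    · exact tendsto_eLpNorm_zero
  add_mem' := by
    rintro p q ⟨hp, φ, h1, h2, h3⟩ ⟨hq, ψ, k1, k2, k3⟩
    refine ⟨add_mem hp hq, fun n => φ n + ψ n, fun n => (h1 n).add (k1 n), ?_, ?_⟩
    · have h := TendstoH1.add h1 k1 h2 k2
      exact h
    · have h := tendsto_eLpNorm_add (fun n => (h1 n).continuous) (fun n => (k1 n).continuous) h3 k3
      exact h
  smul_mem' := by
    rintro c p ⟨hp, φ, h1, h2, h3⟩
    refine ⟨Submodule.smul_mem _ c hp, fun n => c • φ n, fun n => (h1 n).const_smul c, ?_, ?_⟩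
    · have h := TendstoH1.smul c h1 h2
      exact h
    · exact tendsto_eLpNorm_smul c h3

/-- The trace operator `u ↦ u|_Γ`, the continuous extension to `H¹(Ω)` of the restriction
to `Γ` of smooth functions (an everywhere defined bounded operator `H¹(Ω) → L²(Γ)` when the
boundary is Lipschitz). -/
def trace (Ω : Set (E d)) : L2 Ω →ₗ.[ℂ] L2bd Ω := (traceGraph Ω).toLinearPMap

/-- `H¹_{Γ₀}(Ω)`: functions of `H¹(Ω)` whose trace vanishes on `Γ₀`. -/
def H1Γ₀ (Ω Γ₀ : Set (E d)) : Submodule ℂ (L2 Ω) where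
  carrier := {u | u ∈ H1 Ω ∧ ∃ hu : u ∈ (trace Ω).domain,
    trace Ω ⟨u, hu⟩ =ᵐ[(surf Ω).restrict Γ₀] 0}
  zero_mem' := by
    refine ⟨zero_mem _, zero_mem _, ?_⟩
    have : trace Ω ⟨0, zero_mem _⟩ = 0 := LinearPMap.map_zero _
    rw [this]
    exact ae_restrict_of_ae (Lp.coeFn_zero ℂ 2 (surf Ω))
  add_mem' := by
    rintro u v ⟨hu1, hu, hu'⟩ ⟨hv1, hv, hv'⟩
    refine ⟨add_mem hu1 hv1, add_mem hu hv, ?_⟩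
    have : trace Ω ⟨u + v, add_mem hu hv⟩ = trace Ω ⟨u, hu⟩ + trace Ω ⟨v, hv⟩ :=
      LinearPMap.map_add _ ⟨u, hu⟩ ⟨v, hv⟩
    rw [this]
    filter_upwards [ae_restrict_of_ae (Lp.coeFn_add (trace Ω ⟨u, hu⟩) (trace Ω ⟨v, hv⟩)), hu', hv']
      with x h1 h2 h3
    rw [h1, Pi.add_apply, h2, h3]
    simp
  smul_mem' := by
    rintro c u ⟨hu1, hu, hu'⟩
    refine ⟨Submodule.smul_mem _ c hu1, Submodule.smul_mem _ c hu, ?_⟩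
    have : trace Ω ⟨c • u, Submodule.smul_mem _ c hu⟩ = c • trace Ω ⟨u, hu⟩ :=
      LinearPMap.map_smul _ c ⟨u, hu⟩
    rw [this]
    filter_upwards [ae_restrict_of_ae (Lp.coeFn_smul c (trace Ω ⟨u, hu⟩)), hu'] with x h1 h2
    rw [h1, Pi.smul_apply, h2]
    simp

/-- `H¹_0(Ω)`: the closure of the smooth functions with compact support in `Ω`, in `H¹(Ω)`. -/
def H10 (Ω : Set (E d)) : Submodule ℂ (L2 Ω) where
  carrier := {u | ∃ hu : u ∈ H1 Ω, ∃ φ : ℕ → E d → ℂ, (∀ n, ContDiff ℝ ∞ (φ n)) ∧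
    (∀ n, HasCompactSupport (φ n) ∧ tsupport (φ n) ⊆ Ω) ∧ TendstoH1 Ω φ ⟨u, hu⟩}
  zero_mem' := by
    refine ⟨zero_mem _, fun _ => 0, fun _ => contDiff_const, fun _ => ⟨?_, ?_⟩, ?_⟩
    · exact HasCompactSupport.zero
    · simp [tsupport]
    · exact TendstoH1.zero
  add_mem' := by
    rintro u v ⟨hu, φ, h1, h2, h3⟩ ⟨hv, ψ, k1, k2, k3⟩
    refine ⟨add_mem hu hv, fun n => φ n + ψ n, fun n => (h1 n).add (k1 n), fun n => ⟨?_, ?_⟩, ?_⟩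
    · have h := HasCompactSupport.add (h2 n).1 (k2 n).1
      exact h
    · exact (tsupport_add _ _).trans (Set.union_subset (h2 n).2 (k2 n).2)
    · have h := TendstoH1.add h1 k1 h3 k3
      exact h
  smul_mem' := by
    rintro c u ⟨hu, φ, h1, h2, h3⟩
    have hs : ∀ n, tsupport (c • φ n) ⊆ tsupport (φ n) := fun n =>
      closure_mono (Function.support_const_smul_subset c (φ n))
    refine ⟨Submodule.smul_mem _ c hu, fun n => c • φ n, fun n => (h1 n).const_smul c,
      fun n => ⟨?_, (hs n).trans (h2 n).2⟩, ?_⟩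
    · exact (h2 n).1.of_isClosed_subset (isClosed_tsupport _) (hs n)
    · have h := TendstoH1.smul c h1 h3
      exact h

lemma H1Γ₀_le_H1 (Ω Γ₀ : Set (E d)) : H1Γ₀ Ω Γ₀ ≤ H1 Ω := fun _ h => h.1

lemma H1Γ₀_le_trace (Ω Γ₀ : Set (E d)) : H1Γ₀ Ω Γ₀ ≤ (trace Ω).domain := fun _ h => h.2.choose

lemma H10_le_H1 (Ω : Set (E d)) : H10 Ω ≤ H1 Ω := fun _ h => h.choose

/-- The trace `H¹_{Γ₀}(Ω) → L²(Γ)`. -/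
def traceΓ₀ (Ω Γ₀ : Set (E d)) : H1Γ₀ Ω Γ₀ →ₗ[ℂ] L2bd Ω :=
  (trace Ω).toFun ∘ₗ Submodule.inclusion (H1Γ₀_le_trace Ω Γ₀)

/-- The weak derivative `∂_i` on `H¹_{Γ₀}(Ω)`. -/
def DΓ₀ (Ω Γ₀ : Set (E d)) (i : Fin d) : H1Γ₀ Ω Γ₀ →ₗ[ℂ] L2 Ω :=
  D Ω i ∘ₗ Submodule.inclusion (H1Γ₀_le_H1 Ω Γ₀)

/-- The weak derivative `∂_i` on `H¹_0(Ω)`. -/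
def D0 (Ω : Set (E d)) (i : Fin d) : H10 Ω →ₗ[ℂ] L2 Ω :=
  D Ω i ∘ₗ Submodule.inclusion (H10_le_H1 Ω)

/-! ## Laplacian and normal derivative -/

/-- The graph of the weak Laplacian: `u ∈ H¹(Ω)`, `f ∈ L²(Ω)` and
`∫_Ω ∇u · ∇φ = - ∫_Ω f φ` for all test functions `φ`. -/
def laplacianGraph (Ω : Set (E d)) : Submodule ℂ (L2 Ω × L2 Ω) where
  carrier := {p | ∃ hu : p.1 ∈ H1 Ω, ∀ φ : E d → ℝ, IsTest Ω φ →
    ∑ i, ∫ x in Ω, pd i φ x • D Ω i ⟨p.1, hu⟩ x = - ∫ x in Ω, φ x • p.2 x}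
  zero_mem' := by
    refine ⟨zero_mem _, fun φ hφ => ?_⟩
    have h1 : ∀ i, D Ω i ⟨(0 : L2 Ω × L2 Ω).1, zero_mem _⟩ = 0 := fun i => map_zero (D Ω i)
    simp only [h1, integral_smul_zero, Prod.snd_zero, Finset.sum_const_zero, neg_zero]
  add_mem' := by
    rintro p q ⟨hp, hp'⟩ ⟨hq, hq'⟩
    refine ⟨add_mem hp hq, fun φ hφ => ?_⟩
    have h1 : ∀ i, D Ω i ⟨(p + q).1, add_mem hp hq⟩ = D Ω i ⟨p.1, hp⟩ + D Ω i ⟨q.1, hq⟩ :=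
      fun i => map_add (D Ω i) ⟨p.1, hp⟩ ⟨q.1, hq⟩
    have h2 := hp' φ hφ
    have h3 := hq' φ hφ
    simp only [h1, Prod.snd_add, integral_smul_add (hφ.pd _), integral_smul_add hφ, Finset.sum_add_distrib, h2, h3]
    ring
  smul_mem' := by
    rintro c p ⟨hp, hp'⟩
    refine ⟨Submodule.smul_mem _ c hp, fun φ hφ => ?_⟩
    have h1 : ∀ i, D Ω i ⟨(c • p).1, Submodule.smul_mem _ c hp⟩ = c • D Ω i ⟨p.1, hp⟩ :=
      fun i => map_smul (D Ω i) c ⟨p.1, hp⟩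
    have h2 := hp' φ hφ
    simp only [h1, Prod.smul_snd, integral_smul_smul, ← Finset.mul_sum, h2]
    ring

/-- The weak Laplacian is unique. -/
lemma laplacianGraph_unique {Ω : Set (E d)} (hΩ : IsOpen Ω) (p : L2 Ω × L2 Ω)
    (hp : p ∈ laplacianGraph Ω) (h0 : p.1 = 0) : p.2 = 0 := by
  obtain ⟨u, f⟩ := p
  obtain rfl : u = 0 := h0
  obtain ⟨hu, h⟩ := hp
  refine eq_zero_of_test hΩ _ fun φ hφ => ?_
  have h1 := h φ hφ
  have h2 : ∀ i, D Ω i ⟨((0, f) : L2 Ω × L2 Ω).1, hu⟩ = 0 := fun i => map_zero (D Ω i)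
  simp only [h2, integral_smul_zero, Finset.sum_const_zero] at h1
  exact neg_eq_zero.mp h1.symm

/-- The weak Laplacian, with domain `{u ∈ H¹(Ω) : Δu ∈ L²(Ω)}`. -/
def lap (Ω : Set (E d)) : L2 Ω →ₗ.[ℂ] L2 Ω := (laplacianGraph Ω).toLinearPMap

/-- For `u ∈ H¹(Ω)` with `Δu ∈ L²(Ω)` and `g ∈ L²(Γ₁)`: `∂u/∂ν = g` on `Γ₁` in the weak sense,
i.e. `∫_Ω Δu ψ̄ + ∫_Ω ∇u · ∇ψ̄ = ∫_{Γ₁} g ψ̄ dΓ` for all `ψ ∈ H¹_{Γ₀}(Ω)`. -/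
def HasNormalDeriv (Ω Γ₀ Γ₁ : Set (E d)) (u : H1 Ω) (Δu : L2 Ω) (g : L2bd₁ Ω Γ₁) : Prop :=
  ∀ ψ : H1Γ₀ Ω Γ₀,
    inner ℂ (ψ : L2 Ω) Δu + ∑ i, inner ℂ (DΓ₀ Ω Γ₀ i ψ) (D Ω i u)
      = ∫ x in Γ₁, g x * star (traceΓ₀ Ω Γ₀ ψ x) ∂(surf Ω)

/-- Functions in `H²(Ω)` have their Laplacian in `L²(Ω)`. -/
lemma H2_le_lap {Ω : Set (E d)} (hΩ : IsOpen Ω) : H2 Ω ≤ (lap Ω).domain := by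
  rintro u ⟨hu, hu'⟩
  refine Submodule.mem_map.2 ⟨(u, ∑ i, D Ω i ⟨D Ω i ⟨u, hu⟩, hu' i⟩), ⟨hu, fun φ hφ => ?_⟩, rfl⟩
  have h1 : ∀ i, ∫ x in Ω, pd i φ x • D Ω i ⟨u, hu⟩ x
      = - ∫ x in Ω, φ x • D Ω i ⟨D Ω i ⟨u, hu⟩, hu' i⟩ x :=
    fun i => D_spec hΩ i ⟨D Ω i ⟨u, hu⟩, hu' i⟩ φ hφ
  have h2 : ∀ s : Finset (Fin d), ∀ f : Fin d → L2 Ω,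
      ∫ x in Ω, φ x • (∑ i ∈ s, f i : L2 Ω) x = ∑ i ∈ s, ∫ x in Ω, φ x • f i x := by
    intro s f
    induction s using Finset.induction_on with
    | empty => simp only [Finset.sum_empty, integral_smul_zero]
    | insert i s his ih => rw [Finset.sum_insert his, integral_smul_add hφ, ih,
        Finset.sum_insert his]
  simp only [h1, h2, Finset.sum_neg_distrib]

/-! ## The energy space and the operator -/

/-- The weight `μ(ξ) = |ξ|^{(2α-d)/2}`. -/
def mu (α : ℝ) (ξ : E d) : ℝ := ‖ξ‖ ^ ((2 * α - d) / 2)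

/-- The constant `κ(α,d) = 2 sin(απ) Γ(d/2+1) / (d π^{d/2+1})`. -/
def kappa (α : ℝ) (d : ℕ) : ℝ :=
  2 * Real.sin (α * Real.pi) * Real.Gamma ((d : ℝ) / 2 + 1) /
    (d * Real.pi ^ ((d : ℝ) / 2 + 1))

/-- The energy space `H¹_{Γ₀}(Ω) × L²(Ω) × H¹_0(Ω) × L²(Ω) × L²(Γ₁ × ℝ^d)`; its norm is
`energyNorm` below (not the norm that Lean attaches to a product). -/
abbrev EnergySpace (Ω Γ₀ Γ₁ : Set (E d)) : Type :=
  H1Γ₀ Ω Γ₀ × L2 Ω × H10 Ω × L2 Ω × L2aux Ω Γ₁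

/-- The inner product of the energy space (linear in the first argument):
`∫_Ω (v ṽ* + ∇u·∇ũ* + z z̃* + a ∇y·∇ỹ*) dx + γ κ(α,d) ∫_{Γ₁} ∫_{ℝ^d} w w̃* dξ dΓ`. -/
def energyInner (Ω Γ₀ Γ₁ : Set (E d)) (a γ α : ℝ) :
    EnergySpace Ω Γ₀ Γ₁ → EnergySpace Ω Γ₀ Γ₁ → ℂ
  | (u, v, y, z, w), (u', v', y', z', w') =>
    inner ℂ v' v + ∑ i, inner ℂ (DΓ₀ Ω Γ₀ i u') (DΓ₀ Ω Γ₀ i u)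
      + inner ℂ z' z + a * ∑ i, inner ℂ (D0 Ω i y') (D0 Ω i y)
      + γ * kappa α d * inner ℂ w' w

/-- The norm of the energy space. -/
def energyNorm (Ω Γ₀ Γ₁ : Set (E d)) (a γ α : ℝ) (U : EnergySpace Ω Γ₀ Γ₁) : ℝ :=
  Real.sqrt (energyInner Ω Γ₀ Γ₁ a γ α U U).re

/-- The function `(x, ξ) ↦ -(|ξ|² + η) w(x,ξ) + τ(x) μ(ξ)` on `Γ₁ × ℝ^d`. -/
def auxFun {Ω Γ₁ : Set (E d)} (η α : ℝ) (τ : L2bd Ω) (w : L2aux Ω Γ₁) (p : E d × E d) : ℂ :=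
  -((‖p.2‖ ^ 2 + η : ℝ) : ℂ) * w p + τ p.1 * (mu α p.2 : ℂ)

lemma auxFun_add {Ω Γ₁ : Set (E d)} (η α : ℝ) (τ τ' : L2bd Ω) (w w' : L2aux Ω Γ₁) :
    auxFun η α (τ + τ') (w + w') =ᵐ[surfProd Ω Γ₁] auxFun η α τ w + auxFun η α τ' w' := by
  have h1 := (Measure.quasiMeasurePreserving_fst (μ := (surf Ω).restrict Γ₁)
    (ν := (volume : Measure (E d)))).ae (ae_restrict_of_ae (Lp.coeFn_add τ τ'))
  filter_upwards [h1, Lp.coeFn_add w w'] with p h1 h2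
  rw [Pi.add_apply, auxFun, auxFun, auxFun, h1, h2, Pi.add_apply, Pi.add_apply]
  ring

lemma auxFun_smul {Ω Γ₁ : Set (E d)} (η α : ℝ) (c : ℂ) (τ : L2bd Ω) (w : L2aux Ω Γ₁) :
    auxFun η α (c • τ) (c • w) =ᵐ[surfProd Ω Γ₁] c • auxFun η α τ w := by
  have h1 := (Measure.quasiMeasurePreserving_fst (μ := (surf Ω).restrict Γ₁)
    (ν := (volume : Measure (E d)))).ae (ae_restrict_of_ae (Lp.coeFn_smul c τ))
  filter_upwards [h1, Lp.coeFn_smul c w] with p h1 h2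
  rw [Pi.smul_apply, auxFun, auxFun, h1, h2, Pi.smul_apply, Pi.smul_apply]
  simp only [smul_eq_mul]
  ring

lemma auxFun_zero {Ω Γ₁ : Set (E d)} (η α : ℝ) :
    auxFun η α (0 : L2bd Ω) (0 : L2aux Ω Γ₁) =ᵐ[surfProd Ω Γ₁] 0 := by
  have h := auxFun_smul η α 0 (0 : L2bd Ω) (0 : L2aux Ω Γ₁)
  rwa [smul_zero, smul_zero, zero_smul] at h

/-- `g + γ κ(α,d) ∫_{ℝ^d} μ(ξ) w(·,ξ) dξ = 0` on `Γ₁`, the integral being absolutely convergent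
(which is automatic when `w` and `|ξ| w` are in `L²(Γ₁ × ℝ^d)`). -/
def FluxCondition {Ω Γ₁ : Set (E d)} (γ α : ℝ) (g : L2bd₁ Ω Γ₁) (w : L2aux Ω Γ₁) : Prop :=
  ∀ᵐ x ∂((surf Ω).restrict Γ₁), Integrable (fun ξ : E d => (mu α ξ : ℂ) * w (x, ξ)) ∧
    g x + γ * kappa α d * ∫ ξ : E d, (mu α ξ : ℂ) * w (x, ξ) = 0

lemma FluxCondition.add {Ω Γ₁ : Set (E d)} {γ α : ℝ} {g g' : L2bd₁ Ω Γ₁} {w w' : L2aux Ω Γ₁}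
    (h : FluxCondition γ α g w) (h' : FluxCondition γ α g' w') :
    FluxCondition γ α (g + g') (w + w') := by
  have h1 : ∀ᵐ x ∂((surf Ω).restrict Γ₁), ∀ᵐ ξ : E d, (w + w' : L2aux Ω Γ₁) (x, ξ)
      = w (x, ξ) + w' (x, ξ) := Measure.ae_ae_of_ae_prod (Lp.coeFn_add w w')
  filter_upwards [h, h', h1, Lp.coeFn_add g g'] with x hx hx' hx1 hg
  have e : (fun ξ : E d => (mu α ξ : ℂ) * (w + w' : L2aux Ω Γ₁) (x, ξ)) =ᵐ[volume]
      fun ξ => (mu α ξ : ℂ) * w (x, ξ) + (mu α ξ : ℂ) * w' (x, ξ) := by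
    filter_upwards [hx1] with ξ hξ
    rw [hξ, mul_add]
  refine ⟨(hx.1.add hx'.1).congr e.symm, ?_⟩
  rw [integral_congr_ae e, integral_add hx.1 hx'.1, hg, Pi.add_apply]
  linear_combination hx.2 + hx'.2

lemma FluxCondition.smul {Ω Γ₁ : Set (E d)} {γ α : ℝ} {g : L2bd₁ Ω Γ₁} {w : L2aux Ω Γ₁} (c : ℂ)
    (h : FluxCondition γ α g w) : FluxCondition γ α (c • g) (c • w) := by
  have h1 : ∀ᵐ x ∂((surf Ω).restrict Γ₁), ∀ᵐ ξ : E d, (c • w : L2aux Ω Γ₁) (x, ξ)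
      = c • w (x, ξ) := Measure.ae_ae_of_ae_prod (Lp.coeFn_smul c w)
  filter_upwards [h, h1, Lp.coeFn_smul c g] with x hx hx1 hg
  have e : (fun ξ : E d => (mu α ξ : ℂ) * (c • w : L2aux Ω Γ₁) (x, ξ)) =ᵐ[volume]
      fun ξ => c * ((mu α ξ : ℂ) * w (x, ξ)) := by
    filter_upwards [hx1] with ξ hξ
    rw [hξ, smul_eq_mul]
    ring
  refine ⟨(hx.1.const_mul c).congr e.symm, ?_⟩
  rw [integral_congr_ae e, integral_const_mul, hg, Pi.smul_apply, smul_eq_mul]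
  linear_combination c * hx.2

lemma FluxCondition.zero {Ω Γ₁ : Set (E d)} {γ α : ℝ} :
    FluxCondition γ α (0 : L2bd₁ Ω Γ₁) (0 : L2aux Ω Γ₁) := by
  have h1 : ∀ᵐ x ∂((surf Ω).restrict Γ₁), ∀ᵐ ξ : E d, (0 : L2aux Ω Γ₁) (x, ξ) = 0 :=
    Measure.ae_ae_of_ae_prod (Lp.coeFn_zero ℂ 2 (surfProd Ω Γ₁))
  filter_upwards [h1, Lp.coeFn_zero ℂ 2 ((surf Ω).restrict Γ₁)] with x hx1 hg
  have e : (fun ξ : E d => (mu α ξ : ℂ) * (0 : L2aux Ω Γ₁) (x, ξ)) =ᵐ[volume] fun _ => (0 : ℂ) := by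
    filter_upwards [hx1] with ξ hξ
    rw [hξ, mul_zero]
  refine ⟨(integrable_zero _ _ _).congr e.symm, ?_⟩
  rw [integral_congr_ae e, hg]
  simp

lemma HasNormalDeriv.add {Ω Γ₀ Γ₁ : Set (E d)} {u u' : H1 Ω} {f f' : L2 Ω} {g g' : L2bd₁ Ω Γ₁}
    (h : HasNormalDeriv Ω Γ₀ Γ₁ u f g) (h' : HasNormalDeriv Ω Γ₀ Γ₁ u' f' g') :
    HasNormalDeriv Ω Γ₀ Γ₁ (u + u') (f + f') (g + g') := by
  intro ψ
  have hτ : MemLp (fun x => star (traceΓ₀ Ω Γ₀ ψ x)) 2 ((surf Ω).restrict Γ₁) :=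
    ((Lp.memLp (traceΓ₀ Ω Γ₀ ψ)).restrict Γ₁).star
  have hi : ∀ k : L2bd₁ Ω Γ₁, Integrable (fun x => k x * star (traceΓ₀ Ω Γ₀ ψ x))
      ((surf Ω).restrict Γ₁) := fun k => MemLp.integrable_mul (Lp.memLp k) hτ
  have e : ∫ x in Γ₁, (g + g' : L2bd₁ Ω Γ₁) x * star (traceΓ₀ Ω Γ₀ ψ x) ∂(surf Ω)
      = ∫ x in Γ₁, (g x * star (traceΓ₀ Ω Γ₀ ψ x) + g' x * star (traceΓ₀ Ω Γ₀ ψ x))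
        ∂(surf Ω) := by
    apply integral_congr_ae
    filter_upwards [Lp.coeFn_add g g'] with x hx
    rw [hx, Pi.add_apply, add_mul]
  rw [e, integral_add (hi g) (hi g'), ← h ψ, ← h' ψ]
  simp only [map_add, inner_add_right, Finset.sum_add_distrib]
  ring

lemma HasNormalDeriv.smul {Ω Γ₀ Γ₁ : Set (E d)} {u : H1 Ω} {f : L2 Ω} {g : L2bd₁ Ω Γ₁} (c : ℂ)
    (h : HasNormalDeriv Ω Γ₀ Γ₁ u f g) :
    HasNormalDeriv Ω Γ₀ Γ₁ (c • u) (c • f) (c • g) := by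
  intro ψ
  have e : ∫ x in Γ₁, (c • g : L2bd₁ Ω Γ₁) x * star (traceΓ₀ Ω Γ₀ ψ x) ∂(surf Ω)
      = ∫ x in Γ₁, c * (g x * star (traceΓ₀ Ω Γ₀ ψ x)) ∂(surf Ω) := by
    apply integral_congr_ae
    filter_upwards [Lp.coeFn_smul c g] with x hx
    rw [hx, Pi.smul_apply, smul_eq_mul, mul_assoc]
  rw [e, integral_const_mul, ← h ψ]
  simp only [map_smul, inner_smul_right, ← Finset.mul_sum]
  ring

lemma HasNormalDeriv.zero {Ω Γ₀ Γ₁ : Set (E d)} :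
    HasNormalDeriv Ω Γ₀ Γ₁ (0 : H1 Ω) (0 : L2 Ω) (0 : L2bd₁ Ω Γ₁) := by
  intro ψ
  have e : ∫ x in Γ₁, (0 : L2bd₁ Ω Γ₁) x * star (traceΓ₀ Ω Γ₀ ψ x) ∂(surf Ω) = 0 := by
    apply integral_eq_zero_of_ae
    filter_upwards [Lp.coeFn_zero ℂ 2 ((surf Ω).restrict Γ₁)] with x hx
    rw [hx]
    simp
  rw [e]
  simp only [map_zero, inner_zero_right, Finset.sum_const_zero, add_zero]

/-- The domain of the operator: all `U = (u, v, y, z, w)` in the energy space with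
* `Δu ∈ L²(Ω)`, `y ∈ H²(Ω) ∩ H¹_0(Ω)` (so that `Δy ∈ L²(Ω)`),
* `v ∈ H¹_{Γ₀}(Ω)`, `z ∈ H¹_0(Ω)`,
* `-(|ξ|² + η) w + v|_{Γ₁} μ(ξ) ∈ L²(Γ₁ × ℝ^d)`, `|ξ| w ∈ L²(Γ₁ × ℝ^d)`,
* `∂u/∂ν + γ κ(α,d) ∫_{ℝ^d} μ(ξ) w(·,ξ) dξ = 0` on `Γ₁`. -/
def domA (Ω Γ₀ Γ₁ : Set (E d)) (γ α η : ℝ) : Submodule ℂ (EnergySpace Ω Γ₀ Γ₁) where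
  carrier := {U | ∃ (hu : (U.1 : L2 Ω) ∈ (lap Ω).domain) (hv : U.2.1 ∈ H1Γ₀ Ω Γ₀),
    (U.2.2.1 : L2 Ω) ∈ (lap Ω).domain ∧ (U.2.2.1 : L2 Ω) ∈ H2 Ω ∧ U.2.2.2.1 ∈ H10 Ω ∧
    MemLp (auxFun η α (traceΓ₀ Ω Γ₀ ⟨U.2.1, hv⟩) U.2.2.2.2) 2 (surfProd Ω Γ₁) ∧
    MemLp (fun p : E d × E d => (‖p.2‖ : ℂ) * U.2.2.2.2 p) 2 (surfProd Ω Γ₁) ∧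
    ∃ g : L2bd₁ Ω Γ₁,
      HasNormalDeriv Ω Γ₀ Γ₁ (Submodule.inclusion (H1Γ₀_le_H1 Ω Γ₀) U.1) (lap Ω ⟨U.1, hu⟩) g ∧
      FluxCondition γ α g U.2.2.2.2}
  zero_mem' := by
    refine ⟨zero_mem _, zero_mem _, zero_mem _, zero_mem _, zero_mem _, ?_, ?_, 0, ?_, ?_⟩
    · have h : traceΓ₀ Ω Γ₀ ⟨(0 : EnergySpace Ω Γ₀ Γ₁).2.1, zero_mem _⟩ = 0 :=
        map_zero (traceΓ₀ Ω Γ₀)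
      rw [h]
      exact (MemLp.zero (p := 2)).ae_eq (auxFun_zero η α).symm
    · refine (MemLp.zero (p := 2)).ae_eq ?_
      filter_upwards [Lp.coeFn_zero ℂ 2 (surfProd Ω Γ₁)] with p hp
      have h : (0 : EnergySpace Ω Γ₀ Γ₁).2.2.2.2 = 0 := rfl
      rw [h, hp]
      simp
    · have h1 : lap Ω ⟨((0 : EnergySpace Ω Γ₀ Γ₁).1 : L2 Ω), zero_mem _⟩ = 0 :=
        LinearPMap.map_zero (lap Ω)
      rw [h1]
      have h := HasNormalDeriv.zero (Ω := Ω) (Γ₀ := Γ₀) (Γ₁ := Γ₁)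
      exact h
    · exact FluxCondition.zero
  add_mem' := by
    rintro U V hU hV
    obtain ⟨hu, hv, hy, hy2, hz, h1, h2, g, hn, hg⟩ := hU
    obtain ⟨ku, kv, ky, ky2, kz, k1, k2, k, kn, kg⟩ := hV
    refine ⟨add_mem hu ku, add_mem hv kv, add_mem hy ky, add_mem hy2 ky2, add_mem hz kz, ?_, ?_,
      g + k, ?_, ?_⟩
    · have h : traceΓ₀ Ω Γ₀ ⟨(U + V).2.1, add_mem hv kv⟩
          = traceΓ₀ Ω Γ₀ ⟨U.2.1, hv⟩ + traceΓ₀ Ω Γ₀ ⟨V.2.1, kv⟩ :=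
        map_add (traceΓ₀ Ω Γ₀) ⟨U.2.1, hv⟩ ⟨V.2.1, kv⟩
      rw [h]
      exact (h1.add k1).ae_eq (auxFun_add η α _ _ _ _).symm
    · refine (h2.add k2).ae_eq ?_
      filter_upwards [Lp.coeFn_add U.2.2.2.2 V.2.2.2.2] with p hp
      have h : (U + V).2.2.2.2 = U.2.2.2.2 + V.2.2.2.2 := rfl
      rw [h, hp, Pi.add_apply, Pi.add_apply, mul_add]
    · have h : lap Ω ⟨((U + V).1 : L2 Ω), add_mem hu ku⟩ = lap Ω ⟨U.1, hu⟩ + lap Ω ⟨V.1, ku⟩ :=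
        LinearPMap.map_add (lap Ω) ⟨U.1, hu⟩ ⟨V.1, ku⟩
      rw [h]
      have h' := HasNormalDeriv.add hn kn
      exact h'
    · exact hg.add kg
  smul_mem' := by
    rintro c U hU
    obtain ⟨hu, hv, hy, hy2, hz, h1, h2, g, hn, hg⟩ := hU
    refine ⟨Submodule.smul_mem _ c hu, Submodule.smul_mem _ c hv, Submodule.smul_mem _ c hy,
      Submodule.smul_mem _ c hy2, Submodule.smul_mem _ c hz, ?_, ?_, c • g, ?_, ?_⟩
    · have h : traceΓ₀ Ω Γ₀ ⟨(c • U).2.1, Submodule.smul_mem _ c hv⟩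
          = c • traceΓ₀ Ω Γ₀ ⟨U.2.1, hv⟩ := map_smul (traceΓ₀ Ω Γ₀) c ⟨U.2.1, hv⟩
      rw [h]
      exact (h1.const_smul c).ae_eq (auxFun_smul η α c _ _).symm
    · refine (h2.const_smul c).ae_eq ?_
      filter_upwards [Lp.coeFn_smul c U.2.2.2.2] with p hp
      have h : (c • U).2.2.2.2 = c • U.2.2.2.2 := rfl
      rw [h, hp, Pi.smul_apply, Pi.smul_apply, smul_eq_mul, smul_eq_mul]
      ring
    · have h : lap Ω ⟨((c • U).1 : L2 Ω), Submodule.smul_mem _ c hu⟩ = c • lap Ω ⟨U.1, hu⟩ :=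
        LinearPMap.map_smul (lap Ω) c ⟨U.1, hu⟩
      rw [h]
      have h' := HasNormalDeriv.smul c hn
      exact h'
    · exact hg.smul c

lemma domA_u {Ω Γ₀ Γ₁ : Set (E d)} {γ α η : ℝ} {U : EnergySpace Ω Γ₀ Γ₁}
    (h : U ∈ domA Ω Γ₀ Γ₁ γ α η) : (U.1 : L2 Ω) ∈ (lap Ω).domain := h.choose

lemma domA_v {Ω Γ₀ Γ₁ : Set (E d)} {γ α η : ℝ} {U : EnergySpace Ω Γ₀ Γ₁}
    (h : U ∈ domA Ω Γ₀ Γ₁ γ α η) : U.2.1 ∈ H1Γ₀ Ω Γ₀ := h.choose_spec.choose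

lemma domA_y {Ω Γ₀ Γ₁ : Set (E d)} {γ α η : ℝ} {U : EnergySpace Ω Γ₀ Γ₁}
    (h : U ∈ domA Ω Γ₀ Γ₁ γ α η) : (U.2.2.1 : L2 Ω) ∈ (lap Ω).domain :=
  h.choose_spec.choose_spec.1

lemma domA_z {Ω Γ₀ Γ₁ : Set (E d)} {γ α η : ℝ} {U : EnergySpace Ω Γ₀ Γ₁}
    (h : U ∈ domA Ω Γ₀ Γ₁ γ α η) : U.2.2.2.1 ∈ H10 Ω := h.choose_spec.choose_spec.2.2.1

lemma domA_w {Ω Γ₀ Γ₁ : Set (E d)} {γ α η : ℝ} {U : EnergySpace Ω Γ₀ Γ₁}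
    (h : U ∈ domA Ω Γ₀ Γ₁ γ α η) :
    MemLp (auxFun η α (traceΓ₀ Ω Γ₀ ⟨U.2.1, domA_v h⟩) U.2.2.2.2) 2 (surfProd Ω Γ₁) :=
  h.choose_spec.choose_spec.2.2.2.1

/-- The operator
`A (u, v, y, z, w) = (v, Δu - b z, z, a Δy + b v, -(|ξ|² + η) w + v|_{Γ₁} μ(ξ))`. -/
def opA (Ω Γ₀ Γ₁ : Set (E d)) (a b γ α η : ℝ) :
    EnergySpace Ω Γ₀ Γ₁ →ₗ.[ℂ] EnergySpace Ω Γ₀ Γ₁ where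
  domain := domA Ω Γ₀ Γ₁ γ α η
  toFun :=
    { toFun := fun U =>
        (⟨U.1.2.1, domA_v U.2⟩,
          lap Ω ⟨U.1.1, domA_u U.2⟩ - (b : ℂ) • U.1.2.2.2.1,
          ⟨U.1.2.2.2.1, domA_z U.2⟩,
          (a : ℂ) • lap Ω ⟨U.1.2.2.1, domA_y U.2⟩ + (b : ℂ) • U.1.2.1,
          (domA_w U.2).toLp)
      map_add' := by
        intro U V
        refine Prod.ext rfl (Prod.ext ?_ (Prod.ext rfl (Prod.ext ?_ ?_)))
        · have h : lap Ω ⟨(U + V).1.1, domA_u (U + V).2⟩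
              = lap Ω ⟨U.1.1, domA_u U.2⟩ + lap Ω ⟨V.1.1, domA_u V.2⟩ :=
            LinearPMap.map_add (lap Ω) ⟨U.1.1, domA_u U.2⟩ ⟨V.1.1, domA_u V.2⟩
          have h' : (U + V).1.2.2.2.1 = U.1.2.2.2.1 + V.1.2.2.2.1 := rfl
          simp only [Prod.snd_add, Prod.fst_add, h, h', smul_add]
          abel
        · have h : lap Ω ⟨(U + V).1.2.2.1, domA_y (U + V).2⟩
              = lap Ω ⟨U.1.2.2.1, domA_y U.2⟩ + lap Ω ⟨V.1.2.2.1, domA_y V.2⟩ :=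
            LinearPMap.map_add (lap Ω) ⟨U.1.2.2.1, domA_y U.2⟩ ⟨V.1.2.2.1, domA_y V.2⟩
          have h' : (U + V).1.2.1 = U.1.2.1 + V.1.2.1 := rfl
          simp only [Prod.snd_add, Prod.fst_add, h, h', smul_add]
          abel
        · have h : traceΓ₀ Ω Γ₀ ⟨(U + V).1.2.1, domA_v (U + V).2⟩
              = traceΓ₀ Ω Γ₀ ⟨U.1.2.1, domA_v U.2⟩ + traceΓ₀ Ω Γ₀ ⟨V.1.2.1, domA_v V.2⟩ :=
            map_add (traceΓ₀ Ω Γ₀) ⟨U.1.2.1, domA_v U.2⟩ ⟨V.1.2.1, domA_v V.2⟩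
          simp only [Prod.snd_add]
          rw [← MemLp.toLp_add, MemLp.toLp_eq_toLp_iff, h]
          exact auxFun_add η α _ _ _ _
      map_smul' := by
        intro c U
        refine Prod.ext rfl (Prod.ext ?_ (Prod.ext rfl (Prod.ext ?_ ?_)))
        · have h : lap Ω ⟨(c • U).1.1, domA_u (c • U).2⟩ = c • lap Ω ⟨U.1.1, domA_u U.2⟩ :=
            LinearPMap.map_smul (lap Ω) c ⟨U.1.1, domA_u U.2⟩
          have h' : (c • U).1.2.2.2.1 = c • U.1.2.2.2.1 := rfl
          simp only [Prod.smul_snd, Prod.smul_fst, h, h', smul_sub, RingHom.id_apply]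
          rw [smul_comm]
        · have h : lap Ω ⟨(c • U).1.2.2.1, domA_y (c • U).2⟩
              = c • lap Ω ⟨U.1.2.2.1, domA_y U.2⟩ :=
            LinearPMap.map_smul (lap Ω) c ⟨U.1.2.2.1, domA_y U.2⟩
          have h' : (c • U).1.2.1 = c • U.1.2.1 := rfl
          simp only [Prod.smul_snd, Prod.smul_fst, h, h', smul_add, RingHom.id_apply]
          rw [smul_comm c (a : ℂ), smul_comm c (b : ℂ)]
        · have h : traceΓ₀ Ω Γ₀ ⟨(c • U).1.2.1, domA_v (c • U).2⟩
              = c • traceΓ₀ Ω Γ₀ ⟨U.1.2.1, domA_v U.2⟩ :=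
            map_smul (traceΓ₀ Ω Γ₀) c ⟨U.1.2.1, domA_v U.2⟩
          simp only [Prod.smul_snd, RingHom.id_apply]
          rw [← MemLp.toLp_const_smul, MemLp.toLp_eq_toLp_iff, h]
          exact auxFun_smul η α c _ _ }

/-! ## Invertibility and spectrum of unbounded operators -/

/-- An unbounded operator `T` on a space with norm `N` is (boundedly) invertible: it is a bijection
from its domain onto the whole space and its inverse is bounded. -/
def IsInvertible {H : Type*} [AddCommGroup H] [Module ℂ H] (N : H → ℝ) (T : H →ₗ.[ℂ] H) : Prop :=
  Function.Bijective (fun U : T.domain => T U) ∧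
    ∃ C : ℝ, ∀ U : T.domain, N (U : H) ≤ C * N (T U)

/-- The operator `l I - T`, with the domain of `T`. -/
def shift {H : Type*} [AddCommGroup H] [Module ℂ H] (l : ℂ) (T : H →ₗ.[ℂ] H) : H →ₗ.[ℂ] H :=
  (l • LinearMap.id : H →ₗ[ℂ] H) +ᵥ (-T)

/-- The spectrum of an unbounded operator `T` on a space with norm `N`: the set of all `l` for
which `l I - T` is not invertible. -/
def spectrumOf {H : Type*} [AddCommGroup H] [Module ℂ H] (N : H → ℝ) (T : H →ₗ.[ℂ] H) : Set ℂ :=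
  {l | ¬ IsInvertible N (shift l T)}

end CoupledWave

end

/-!
If `-A (u, v, y, z, w) = (φ, 0, 0, 0, 0)` with `η = 0`, then `v = -φ` and
`|ξ|² w = -φ|_{Γ₁} μ(ξ)`, so that `w = -|ξ|^{(2α-d-4)/2} φ|_{Γ₁}`. This is never in
`L²(Γ₁ × ℝ^d)` unless `φ|_{Γ₁} = 0`, because no power of `|ξ|` is integrable over `ℝ^d`.

That some `φ` has a nonzero trace rests on the boundary being locally a Lipschitz graph.
Integrating the derivative of a smooth function along the graph direction bounds its boundary
values by its `W^{1,1}` norm inside `Ω`, so the trace is single-valued and agrees with restriction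
on smooth functions; and a neighbourhood of a boundary point has positive surface measure, so a
bump function supported away from `Γ₀` does not vanish almost everywhere on `Γ₁`.
-/

namespace CoupledWave

open Metric Module Set

lemma euclideanHausdorffMeasure_image_le {X Y : Type*} [EMetricSpace X] [MeasurableSpace X]
    [BorelSpace X] [EMetricSpace Y] [MeasurableSpace Y] [BorelSpace Y] {K : NNReal} {f : X → Y}
    (hf : LipschitzWith K f) (n : ℕ) (s : Set X) :
    μHE[n] (f '' s) ≤ (K : ℝ≥0∞) ^ n * μHE[n] s := by
  simp only [Measure.euclideanHausdorffMeasure_def, Measure.smul_apply, ENNReal.smul_def,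
    smul_eq_mul]
  rw [mul_left_comm, ← ENNReal.rpow_natCast]
  gcongr
  exact hf.hausdorffMeasure_image_le n.cast_nonneg s

/-! ### A one-dimensional trace inequality -/

lemma enorm_le_add_lintegral_segment {V F : Type*} [NormedAddCommGroup V] [NormedSpace ℝ V]
    [NormedAddCommGroup F] [NormedSpace ℝ F] [CompleteSpace F] {φ : V → F} (hφ : ContDiff ℝ 1 φ)
    (p e : V) {s : ℝ} (hs : 0 ≤ s) :
    ‖φ p‖ₑ ≤ ‖φ (p + s • e)‖ₑ + ∫⁻ t in Ioc 0 s, ‖fderiv ℝ φ (p + t • e) e‖ₑ := by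
  have hderiv (t : ℝ) :
      HasDerivAt (fun t : ℝ => φ (p + t • e)) (fderiv ℝ φ (p + t • e) e) t := by
    have hline : HasDerivAt (fun t : ℝ => p + t • e) e t := by
      simpa using ((hasDerivAt_id t).smul_const e).const_add p
    exact (hφ.differentiable one_ne_zero _).hasFDerivAt.comp_hasDerivAt t hline
  have hcont : Continuous fun t : ℝ => fderiv ℝ φ (p + t • e) e := by
    have := hφ.continuous_fderiv one_ne_zero
    fun_prop
  have hftc := intervalIntegral.integral_eq_sub_of_hasDerivAt (a := 0) (b := s)
    (fun t _ => hderiv t) (hcont.intervalIntegrable _ _)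
  rw [zero_smul, add_zero, intervalIntegral.integral_of_le hs] at hftc
  calc ‖φ p‖ₑ = ‖φ (p + s • e) - ∫ t in Ioc 0 s, fderiv ℝ φ (p + t • e) e‖ₑ := by
        rw [hftc, sub_sub_cancel]
    _ ≤ ‖φ (p + s • e)‖ₑ + ‖∫ t in Ioc 0 s, fderiv ℝ φ (p + t • e) e‖ₑ := enorm_sub_le
    _ ≤ _ := by gcongr; exact enorm_integral_le_lintegral_enorm _

lemma ofReal_mul_enorm_le_lintegral_segment {V F : Type*} [NormedAddCommGroup V]
    [NormedSpace ℝ V] [NormedAddCommGroup F] [NormedSpace ℝ F] [CompleteSpace F] {φ : V → F}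
    (hφ : ContDiff ℝ 1 φ) (p e : V) (δ : ℝ) :
    ENNReal.ofReal δ * ‖φ p‖ₑ ≤ (∫⁻ t in Ioo 0 δ, ‖φ (p + t • e)‖ₑ)
      + ENNReal.ofReal δ * ∫⁻ t in Ioo 0 δ, ‖fderiv ℝ φ (p + t • e) e‖ₑ := by
  have hpt : ∀ s ∈ Ioo 0 δ, ‖φ p‖ₑ ≤ ‖φ (p + s • e)‖ₑ
      + ∫⁻ t in Ioo 0 δ, ‖fderiv ℝ φ (p + t • e) e‖ₑ := fun s hs =>
    (enorm_le_add_lintegral_segment hφ p e hs.1.le).trans <| by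
      gcongr
      exact hs.2
  have hint := setLIntegral_mono' (μ := volume) measurableSet_Ioo hpt
  rwa [setLIntegral_const, lintegral_add_right _ measurable_const, setLIntegral_const,
    Real.volume_Ioo, sub_zero, mul_comm, mul_comm _ (ENNReal.ofReal δ)] at hint

/-! ### Coordinates over a hyperplane -/

section Hyperplane

variable {V : Type*} [NormedAddCommGroup V] [InnerProductSpace ℝ V] {e : V}

lemma inner_coe_add_smul (he : ‖e‖ = 1) (v : (ℝ ∙ e)ᗮ) (t : ℝ) :
    inner ℝ e ((v : V) + t • e) = t := by
  rw [inner_add_right, Submodule.mem_orthogonal_singleton_iff_inner_right.1 v.2,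
    inner_smul_right, real_inner_self_eq_norm_sq, he, zero_add, one_pow, mul_one]

lemma coe_orthogonalProjectionOnto_orthogonal (he : ‖e‖ = 1) (y : V) :
    ((ℝ ∙ e)ᗮ.orthogonalProjectionOnto y : V) = y - inner ℝ e y • e := by
  rw [← Submodule.starProjection_unit_singleton ℝ he y, ← Submodule.starProjection_apply]
  exact Submodule.starProjection_orthogonal_val y

lemma orthogonalProjectionOnto_coe_add_smul (he : ‖e‖ = 1) (v : (ℝ ∙ e)ᗮ) (t : ℝ) :
    (ℝ ∙ e)ᗮ.orthogonalProjectionOnto ((v : V) + t • e) = v := by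
  ext
  rw [coe_orthogonalProjectionOnto_orthogonal he, inner_coe_add_smul he, add_sub_cancel_right]

section Measure

variable [FiniteDimensional ℝ V]

lemma finrank_orthogonal_span_singleton (he : ‖e‖ = 1) :
    finrank ℝ (ℝ ∙ e)ᗮ = finrank ℝ V - 1 := by
  have he₀ : e ≠ 0 := norm_ne_zero_iff.1 (he ▸ one_ne_zero)
  rw [← (ℝ ∙ e).finrank_add_finrank_orthogonal, finrank_span_singleton he₀,
    Nat.add_sub_cancel_left]

variable [MeasurableSpace V] [BorelSpace V]

lemma isAddHaarMeasure_orthogonal_span_singleton (he : ‖e‖ = 1) :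
    (μHE[finrank ℝ V - 1] : Measure (ℝ ∙ e)ᗮ).IsAddHaarMeasure := by
  rw [← finrank_orthogonal_span_singleton he]
  infer_instance

lemma measurePreserving_coe_add_smul (he : ‖e‖ = 1) :
    MeasurePreserving (fun p : (ℝ ∙ e)ᗮ × ℝ => (p.1 : V) + p.2 • e)
      (μHE[finrank ℝ V - 1].prod volume) volume := by
  have hline : MeasurePreserving (LinearIsometryEquiv.toSpanUnitSingleton (𝕜 := ℝ) e he) :=
    LinearIsometryEquiv.measurePreserving _
  have hsum : MeasurePreserving ((ℝ ∙ e).measurableEquivProd (0 : V)).symm volume volume := by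
    rw [← InnerProductSpace.euclideanHausdorffMeasure_eq_volume (V := V)]
    exact ((ℝ ∙ e).measurePreserving_measurableEquivProd (0 : V)).symm
  rw [← finrank_orthogonal_span_singleton he,
    InnerProductSpace.euclideanHausdorffMeasure_eq_volume]
  convert hsum.comp ((hline.prod (MeasurePreserving.id volume)).comp
    Measure.measurePreserving_swap) using 1
  ext p
  simp [add_comm]

lemma lintegral_lintegral_coe_add_smul (he : ‖e‖ = 1) {f : V → ℝ≥0∞} (hf : Measurable f) :
    ∫⁻ v : (ℝ ∙ e)ᗮ, (∫⁻ t : ℝ, f (v + t • e)) ∂μHE[finrank ℝ V - 1] = ∫⁻ y, f y := by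
  have := isAddHaarMeasure_orthogonal_span_singleton he
  have hmp := measurePreserving_coe_add_smul he
  rw [← hmp.lintegral_comp hf]
  exact (lintegral_prod _ (hf.comp hmp.measurable).aemeasurable).symm

end Measure

/-! ### Lipschitz graphs -/

/-- The parametrisation `v ↦ v + h(v) e` of the graph of `h` over the hyperplane orthogonal
to `e`. -/
noncomputable def graphMap (e : V) (h : V → ℝ) (v : (ℝ ∙ e)ᗮ) : V := v + h v • e

lemma lipschitzWith_graphMap (he : ‖e‖ = 1) {h : V → ℝ} {K : NNReal} (hh : LipschitzWith K h) :
    LipschitzWith (1 + K) (graphMap e h) := by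
  have hsmul : LipschitzWith K fun v : (ℝ ∙ e)ᗮ => h v • e := by
    refine LipschitzWith.of_dist_le_mul fun v w => ?_
    rw [dist_eq_norm, ← sub_smul, norm_smul, he, mul_one, ← dist_eq_norm]
    exact hh.dist_le_mul v w
  exact (LipschitzWith.subtype_val _).add hsmul

/-- A boundary chart of `Ω` at `x`: inside `ball x r`, the set `Ω` is the strict epigraph, in the
unit direction `e`, of the `K`-Lipschitz function `h`. The function `h` is defined on the whole
space, but only its values on the hyperplane orthogonal to `e` matter. -/
structure IsLipschitzChart (Ω : Set V) (x e : V) (h : V → ℝ) (K : NNReal) (r : ℝ) : Prop where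
  norm_eq : ‖e‖ = 1
  lipschitz : LipschitzWith K h
  pos : 0 < r
  mem_iff : ∀ y ∈ ball x r, (y ∈ Ω ↔ h (y - inner ℝ e y • e) < inner ℝ e y)

namespace IsLipschitzChart

variable {Ω : Set V} {x : V} {h : V → ℝ} {K : NNReal} {r : ℝ}

lemma lipschitzWith_graphMap (hc : IsLipschitzChart Ω x e h K r) :
    LipschitzWith (1 + K) (graphMap e h) :=
  CoupledWave.lipschitzWith_graphMap hc.norm_eq hc.lipschitz

lemma continuous_graphMap (hc : IsLipschitzChart Ω x e h K r) : Continuous (graphMap e h) :=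
  hc.lipschitzWith_graphMap.continuous

lemma isOpen_inter_ball (hc : IsLipschitzChart Ω x e h K r) : IsOpen (Ω ∩ ball x r) := by
  have hh := hc.lipschitz.continuous
  have hlt : IsOpen {y | h (y - inner ℝ e y • e) < inner ℝ e y} :=
    isOpen_lt (by fun_prop) (by fun_prop)
  have heq : Ω ∩ ball x r = {y | h (y - inner ℝ e y • e) < inner ℝ e y} ∩ ball x r :=
    ext fun y => and_congr_left fun hy => hc.mem_iff y hy
  exact heq ▸ hlt.inter isOpen_ball

lemma graphMap_add_mem_iff (hc : IsLipschitzChart Ω x e h K r) {v : (ℝ ∙ e)ᗮ} {t : ℝ}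
    (hv : graphMap e h v + t • e ∈ ball x r) : graphMap e h v + t • e ∈ Ω ↔ 0 < t := by
  rw [hc.mem_iff _ hv, graphMap, add_assoc, ← add_smul, inner_coe_add_smul hc.norm_eq,
    add_sub_cancel_right, lt_add_iff_pos_right]

lemma graphMap_mem_frontier (hc : IsLipschitzChart Ω x e h K r) {v : (ℝ ∙ e)ᗮ}
    (hv : graphMap e h v ∈ ball x r) : graphMap e h v ∈ frontier Ω := by
  have hnear : Tendsto (fun t : ℝ => graphMap e h v + t • e) (𝓝[>] 0) (𝓝 (graphMap e h v)) := by
    have hcont : Continuous fun t : ℝ => graphMap e h v + t • e := by fun_prop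
    simpa using (hcont.tendsto 0).mono_left nhdsWithin_le_nhds
  rw [frontier_eq_closure_inter_closure]
  refine ⟨mem_closure_of_tendsto hnear ?_, subset_closure fun hΩ => ?_⟩
  · filter_upwards [hnear (isOpen_ball.mem_nhds hv), self_mem_nhdsWithin] with t hball ht
    exact (hc.graphMap_add_mem_iff hball).2 ht
  · simpa [hΩ] using hc.graphMap_add_mem_iff (v := v) (t := 0) (by simpa using hv)

lemma graphMap_orthogonalProjectionOnto (hc : IsLipschitzChart Ω x e h K r) {y : V}
    (hy : y ∈ ball x r) (hfr : y ∈ frontier Ω) :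
    graphMap e h ((ℝ ∙ e)ᗮ.orthogonalProjectionOnto y) = y := by
  have hh := hc.lipschitz.continuous
  have hle : h (y - inner ℝ e y • e) ≤ inner ℝ e y := by
    have hclosed : IsClosed {z | h (z - inner ℝ e z • e) ≤ inner ℝ e z} :=
      isClosed_le (by fun_prop) (by fun_prop)
    refine closure_minimal (fun z hz => ?_) hclosed
      (isOpen_ball.inter_closure ⟨hy, frontier_subset_closure hfr⟩)
    exact ((hc.mem_iff z hz.1).1 hz.2).le
  have hnlt : ¬ h (y - inner ℝ e y • e) < inner ℝ e y := fun hlt =>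
    hfr.2 (interior_maximal inter_subset_left hc.isOpen_inter_ball ⟨(hc.mem_iff y hy).2 hlt, hy⟩)
  rw [graphMap, coe_orthogonalProjectionOnto_orthogonal hc.norm_eq, hle.antisymm (not_lt.1 hnlt),
    sub_add_cancel]

section Measure

variable [MeasurableSpace V] [BorelSpace V]

lemma euclideanHausdorffMeasure_inter_frontier_le (hc : IsLipschitzChart Ω x e h K r) (n : ℕ)
    {A : Set V} (hA : A ⊆ ball x r) :
    μHE[n] (A ∩ frontier Ω) ≤ ((1 + K : NNReal) : ℝ≥0∞) ^ n * μHE[n] (graphMap e h ⁻¹' A) := by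
  refine (measure_mono fun y hy => ?_).trans
    (euclideanHausdorffMeasure_image_le hc.lipschitzWith_graphMap n _)
  have hy' := hc.graphMap_orthogonalProjectionOnto (hA hy.1) hy.2
  exact ⟨_, mem_preimage.2 (hy'.symm ▸ hy.1), hy'⟩

lemma restrict_inter_frontier_le (hc : IsLipschitzChart Ω x e h K r) (n : ℕ) {A : Set V}
    (hA : A ⊆ ball x r) :
    μHE[n].restrict (A ∩ frontier Ω) ≤ ((1 + K : NNReal) : ℝ≥0∞) ^ n •
      (μHE[n].restrict (graphMap e h ⁻¹' A)).map (graphMap e h) := by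
  have hGm := hc.continuous_graphMap.measurable
  refine Measure.le_iff.2 fun S hS => ?_
  rw [Measure.restrict_apply hS, Measure.smul_apply, Measure.map_apply hGm hS,
    Measure.restrict_apply (hGm hS), smul_eq_mul, ← inter_assoc, ← preimage_inter]
  exact hc.euclideanHausdorffMeasure_inter_frontier_le n (inter_subset_right.trans hA)

lemma setLIntegral_inter_frontier_le (hc : IsLipschitzChart Ω x e h K r) (n : ℕ) {A : Set V}
    (hA : A ⊆ ball x r) {f : V → ℝ≥0∞} (hf : Measurable f) :
    ∫⁻ y in A ∩ frontier Ω, f y ∂μHE[n]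
      ≤ ((1 + K : NNReal) : ℝ≥0∞) ^ n * ∫⁻ v in graphMap e h ⁻¹' A, f (graphMap e h v) ∂μHE[n] := by
  refine (lintegral_mono' (hc.restrict_inter_frontier_le n hA) le_rfl).trans ?_
  rw [lintegral_smul_measure, lintegral_map hf hc.continuous_graphMap.measurable, smul_eq_mul]

variable [FiniteDimensional ℝ V]

lemma euclideanHausdorffMeasure_ball_inter_frontier_lt_top (hc : IsLipschitzChart Ω x e h K r) :
    μHE[finrank ℝ V - 1] (ball x r ∩ frontier Ω) < ⊤ := by
  have := isAddHaarMeasure_orthogonal_span_singleton hc.norm_eq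
  refine (hc.euclideanHausdorffMeasure_inter_frontier_le _ subset_rfl).trans_lt
    (ENNReal.mul_lt_top (ENNReal.pow_lt_top ENNReal.coe_lt_top) ?_)
  have hbdd : Bornology.IsBounded (graphMap e h ⁻¹' ball x r) := by
    refine isBounded_iff_subset_ball ((ℝ ∙ e)ᗮ.orthogonalProjectionOnto x) |>.2 ⟨r, fun v hv => ?_⟩
    have hdist := (ℝ ∙ e)ᗮ.lipschitzWith_orthogonalProjectionOnto.dist_le_mul (graphMap e h v) x
    rw [graphMap, orthogonalProjectionOnto_coe_add_smul hc.norm_eq, NNReal.coe_one, one_mul]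
      at hdist
    exact hdist.trans_lt hv
  exact hbdd.measure_lt_top

lemma euclideanHausdorffMeasure_inter_frontier_pos (hc : IsLipschitzChart Ω x e h K r) {O : Set V}
    (hO : O ∈ 𝓝 x) (hx : x ∈ frontier Ω) : 0 < μHE[finrank ℝ V - 1] (O ∩ frontier Ω) := by
  have := isAddHaarMeasure_orthogonal_span_singleton hc.norm_eq
  have hxG := hc.graphMap_orthogonalProjectionOnto (mem_ball_self hc.pos) hx
  have hnhds : graphMap e h ⁻¹' (O ∩ ball x r) ∈ 𝓝 ((ℝ ∙ e)ᗮ.orthogonalProjectionOnto x) :=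
    hc.continuous_graphMap.continuousAt (hxG.symm ▸ inter_mem hO (ball_mem_nhds x hc.pos))
  refine (Measure.measure_pos_of_mem_nhds μHE[finrank ℝ V - 1] hnhds).trans_le ?_
  calc μHE[finrank ℝ V - 1] (graphMap e h ⁻¹' (O ∩ ball x r))
      ≤ μHE[finrank ℝ V - 1] ((ℝ ∙ e)ᗮ.orthogonalProjectionOnto '' (O ∩ frontier Ω)) :=
        measure_mono fun v hv => ⟨graphMap e h v, ⟨hv.1, hc.graphMap_mem_frontier hv.2⟩,
          orthogonalProjectionOnto_coe_add_smul hc.norm_eq v _⟩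
    _ ≤ μHE[finrank ℝ V - 1] (O ∩ frontier Ω) := by
        simpa using euclideanHausdorffMeasure_image_le
          (ℝ ∙ e)ᗮ.lipschitzWith_orthogonalProjectionOnto (finrank ℝ V - 1) (O ∩ frontier Ω)

/-! ### The trace inequality -/

lemma lintegral_collar_le (hc : IsLipschitzChart Ω x e h K r) {f : V → ℝ≥0∞} (hf : Measurable f) :
    ∫⁻ v in graphMap e h ⁻¹' ball x (r / 2), (∫⁻ t in Ioo 0 (r / 2), f (graphMap e h v + t • e))
      ∂μHE[finrank ℝ V - 1] ≤ ∫⁻ y in Ω ∩ ball x r, f y := by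
  have hmeas := hc.isOpen_inter_ball.measurableSet
  rw [← lintegral_indicator hmeas,
    ← lintegral_lintegral_coe_add_smul hc.norm_eq (hf.indicator hmeas)]
  refine (setLIntegral_mono' (hc.continuous_graphMap.measurable measurableSet_ball)
    fun v hv => ?_).trans (setLIntegral_le_lintegral _ _)
  calc ∫⁻ t in Ioo 0 (r / 2), f (graphMap e h v + t • e)
      ≤ ∫⁻ t in Ioo 0 (r / 2), (Ω ∩ ball x r).indicator f ((v : V) + (h v + t) • e) := by
        refine setLIntegral_mono' measurableSet_Ioo fun t ht => ?_
        have hball : graphMap e h v + t • e ∈ ball x r := by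
          have hte : dist (graphMap e h v + t • e) (graphMap e h v) < r / 2 := by
            rw [dist_self_add_left, norm_smul, hc.norm_eq, mul_one, Real.norm_of_nonneg ht.1.le]
            exact ht.2
          exact (dist_triangle _ _ _).trans_lt ((add_lt_add hte hv).trans_eq (add_halves r))
        have hmem : graphMap e h v + t • e ∈ Ω ∩ ball x r :=
          ⟨(hc.graphMap_add_mem_iff hball).2 ht.1, hball⟩
        rw [add_smul, ← add_assoc]
        exact (indicator_of_mem hmem f).ge
    _ ≤ ∫⁻ t, (Ω ∩ ball x r).indicator f ((v : V) + (h v + t) • e) :=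
        setLIntegral_le_lintegral _ _
    _ = ∫⁻ t : ℝ, (Ω ∩ ball x r).indicator f ((v : V) + t • e) :=
        lintegral_add_left_eq_self
          (fun t : ℝ => (Ω ∩ ball x r).indicator f ((v : V) + t • e)) (h v)

lemma mul_lintegral_frontier_le (hc : IsLipschitzChart Ω x e h K r) {F : Type*}
    [NormedAddCommGroup F] [NormedSpace ℝ F] [CompleteSpace F] {φ : V → F} (hφ : ContDiff ℝ 1 φ) :
    ENNReal.ofReal (r / 2) * ∫⁻ y in ball x (r / 2) ∩ frontier Ω, ‖φ y‖ₑ ∂μHE[finrank ℝ V - 1]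
      ≤ ((1 + K : NNReal) : ℝ≥0∞) ^ (finrank ℝ V - 1) * ((∫⁻ y in Ω ∩ ball x r, ‖φ y‖ₑ)
        + ENNReal.ofReal (r / 2) * ∫⁻ y in Ω ∩ ball x r, ‖fderiv ℝ φ y e‖ₑ) := by
  have := isAddHaarMeasure_orthogonal_span_singleton hc.norm_eq
  have hG := hc.continuous_graphMap
  have hm : Measurable fun y => ‖φ y‖ₑ := hφ.continuous.enorm.measurable
  have hm' : Measurable fun y => ‖fderiv ℝ φ y e‖ₑ :=
    ((hφ.continuous_fderiv one_ne_zero).clm_apply continuous_const).enorm.measurable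
  have hinner {f : V → ℝ≥0∞} (hf : Measurable f) :
      Measurable fun v : (ℝ ∙ e)ᗮ => ∫⁻ t in Ioo 0 (r / 2), f (graphMap e h v + t • e) :=
    (hf.comp (by fun_prop : Measurable fun p : (ℝ ∙ e)ᗮ × ℝ =>
      graphMap e h p.1 + p.2 • e)).lintegral_prod_right'
  set δ := ENNReal.ofReal (r / 2)
  set M := ((1 + K : NNReal) : ℝ≥0∞) ^ (finrank ℝ V - 1)
  set B := graphMap e h ⁻¹' ball x (r / 2)
  calc δ * ∫⁻ y in ball x (r / 2) ∩ frontier Ω, ‖φ y‖ₑ ∂μHE[finrank ℝ V - 1]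
      ≤ δ * (M * ∫⁻ v in B, ‖φ (graphMap e h v)‖ₑ ∂μHE[finrank ℝ V - 1]) := by
        gcongr
        exact hc.setLIntegral_inter_frontier_le _ (ball_subset_ball (half_le_self hc.pos.le)) hm
    _ = M * ∫⁻ v in B, δ * ‖φ (graphMap e h v)‖ₑ ∂μHE[finrank ℝ V - 1] := by
        rw [lintegral_const_mul' _ _ ENNReal.ofReal_ne_top, mul_left_comm]
    _ ≤ M * ∫⁻ v in B, ((∫⁻ t in Ioo 0 (r / 2), ‖φ (graphMap e h v + t • e)‖ₑ)
          + δ * ∫⁻ t in Ioo 0 (r / 2), ‖fderiv ℝ φ (graphMap e h v + t • e) e‖ₑ)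
          ∂μHE[finrank ℝ V - 1] := by
        gcongr with v
        exact ofReal_mul_enorm_le_lintegral_segment hφ (graphMap e h v) e (r / 2)
    _ ≤ M * ((∫⁻ y in Ω ∩ ball x r, ‖φ y‖ₑ) + δ * ∫⁻ y in Ω ∩ ball x r, ‖fderiv ℝ φ y e‖ₑ) := by
        rw [lintegral_add_left (hinner hm), lintegral_const_mul _ (hinner hm')]
        gcongr
        · exact hc.lintegral_collar_le hm
        · exact hc.lintegral_collar_le hm'

end Measure

end IsLipschitzChart

end Hyperplane

/-! ### The trace operator -/

section Trace

variable {d : ℕ} {Ω : Set (E d)}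

lemma HasLipschitzBoundary.exists_isLipschitzChart (hL : HasLipschitzBoundary Ω) {x : E d}
    (hx : x ∈ frontier Ω) : ∃ e h K r, IsLipschitzChart Ω x e h K r := by
  obtain ⟨e, h, K, r, he, hh, hr, hmem⟩ := hL x hx
  exact ⟨e, h, K, r, he, hh, hr, hmem⟩

lemma HasLipschitzBoundary.isOpen (hL : HasLipschitzBoundary Ω) : IsOpen Ω := by
  refine subset_interior_iff_isOpen.1 fun x hx => by_contra fun hint => ?_
  obtain ⟨e, h, K, r, hc⟩ := hL.exists_isLipschitzChart ⟨subset_closure hx, hint⟩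
  exact hint (interior_maximal inter_subset_left hc.isOpen_inter_ball ⟨hx, mem_ball_self hc.pos⟩)

lemma surf_apply (A : Set (E d)) : surf Ω A = μHE[d - 1] (A ∩ frontier Ω) :=
  Measure.restrict_apply' isClosed_frontier.measurableSet

lemma IsLipschitzChart.surf_ball_lt_top {x e : E d} {h : E d → ℝ} {K : NNReal} {r : ℝ}
    (hc : IsLipschitzChart Ω x e h K r) : surf Ω (ball x r) < ⊤ := by
  simpa only [surf_apply, finrank_euclideanSpace_fin] using
    hc.euclideanHausdorffMeasure_ball_inter_frontier_lt_top

lemma HasLipschitzBoundary.isLocallyFiniteMeasure_surf (hL : HasLipschitzBoundary Ω) :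
    IsLocallyFiniteMeasure (surf Ω) := by
  refine ⟨fun x => ?_⟩
  by_cases hx : x ∈ frontier Ω
  · obtain ⟨e, h, K, r, hc⟩ := hL.exists_isLipschitzChart hx
    exact ⟨ball x r, ball_mem_nhds x hc.pos, hc.surf_ball_lt_top⟩
  · refine ⟨(frontier Ω)ᶜ, isClosed_frontier.isOpen_compl.mem_nhds hx, ?_⟩
    rw [surf_apply, compl_inter_self, measure_empty]
    exact ENNReal.zero_lt_top

lemma HasLipschitzBoundary.surf_pos (hL : HasLipschitzBoundary Ω) {x : E d}
    (hx : x ∈ frontier Ω) {O : Set (E d)} (hO : O ∈ 𝓝 x) : 0 < surf Ω O := by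
  obtain ⟨e, h, K, r, hc⟩ := hL.exists_isLipschitzChart hx
  simpa only [surf_apply, finrank_euclideanSpace_fin] using
    hc.euclideanHausdorffMeasure_inter_frontier_pos hO hx

lemma tendsto_setLIntegral_enorm_of_tendsto_eLpNorm {X F ι : Type*} [MeasurableSpace X]
    [NormedAddCommGroup F] {μ : Measure X} {p : ℝ≥0∞} (hp : 1 ≤ p) {s : Set X} (hs : μ s ≠ ⊤)
    {l : Filter ι} {f : ι → X → F} (hf : ∀ n, AEStronglyMeasurable (f n) μ)
    (hlim : Tendsto (fun n => eLpNorm (f n) p μ) l (𝓝 0)) :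
    Tendsto (fun n => ∫⁻ x in s, ‖f n x‖ₑ ∂μ) l (𝓝 0) := by
  have hexp : 0 ≤ 1 / (1 : ℝ≥0∞).toReal - 1 / p.toReal := by
    rcases eq_or_ne p ⊤ with rfl | hp'
    · simp
    · have := ENNReal.toReal_mono hp' hp
      rw [ENNReal.toReal_one] at this ⊢
      rw [one_div_one, sub_nonneg]
      exact div_le_one_of_le₀ this ENNReal.toReal_nonneg
  have hle (n : ι) : ∫⁻ x in s, ‖f n x‖ₑ ∂μ
      ≤ eLpNorm (f n) p μ * μ s ^ (1 / (1 : ℝ≥0∞).toReal - 1 / p.toReal) := by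
    rw [← eLpNorm_one_eq_lintegral_enorm]
    refine (eLpNorm_le_eLpNorm_mul_rpow_measure_univ hp (hf n).restrict).trans ?_
    rw [Measure.restrict_apply_univ]
    gcongr
    exact Measure.restrict_le_self
  refine tendsto_of_tendsto_of_tendsto_of_le_of_le tendsto_const_nhds ?_ (fun _ => zero_le) hle
  simpa using ENNReal.Tendsto.mul_const hlim
    (Or.inr (ENNReal.rpow_ne_top_of_nonneg hexp hs))

lemma enorm_fderiv_le_sum_pd {F : Type*} [NormedAddCommGroup F] [NormedSpace ℝ F] (φ : E d → F)
    (y e : E d) : ‖fderiv ℝ φ y e‖ₑ ≤ ∑ i, ‖e i‖ₑ * ‖pd i φ y‖ₑ := by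
  have hbasis : e = ∑ i, e i • EuclideanSpace.single i (1 : ℝ) := by
    simpa using ((EuclideanSpace.basisFun (Fin d) ℝ).sum_repr e).symm
  have hsum : fderiv ℝ φ y e = ∑ i, e i • pd i φ y := by
    conv_lhs => rw [hbasis]
    simp only [map_sum, map_smul, pd]
  rw [hsum]
  refine (enorm_sum_le _ _).trans (Finset.sum_le_sum fun i _ => ?_)
  rw [enorm_smul]

lemma tendsto_setLIntegral_enorm_fderiv {F : Type*} [NormedAddCommGroup F] [NormedSpace ℝ F]
    {μ : Measure (E d)} {p : ℝ≥0∞} (hp : 1 ≤ p) {s : Set (E d)} (hs : μ s ≠ ⊤) {ι : Type*}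
    {l : Filter ι} {φ : ι → E d → F} (hφ : ∀ n, ContDiff ℝ ∞ (φ n))
    (hlim : ∀ i, Tendsto (fun n => eLpNorm (pd i (φ n)) p μ) l (𝓝 0)) (e : E d) :
    Tendsto (fun n => ∫⁻ y in s, ‖fderiv ℝ (φ n) y e‖ₑ ∂μ) l (𝓝 0) := by
  have hcont (n i) : Continuous (pd i (φ n)) := (contDiff_pd i (hφ n)).continuous
  have hsum : Tendsto (fun n => ∑ i, ‖e i‖ₑ * ∫⁻ y in s, ‖pd i (φ n) y‖ₑ ∂μ) l (𝓝 0) := by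
    simpa using tendsto_finsetSum Finset.univ fun i _ => ENNReal.Tendsto.const_mul
      (tendsto_setLIntegral_enorm_of_tendsto_eLpNorm hp hs
        (fun n => (hcont n i).aestronglyMeasurable) (hlim i))
      (Or.inr (enorm_ne_top (x := e i)))
  refine tendsto_of_tendsto_of_tendsto_of_le_of_le tendsto_const_nhds hsum (fun _ => zero_le)
    fun n => ?_
  calc ∫⁻ y in s, ‖fderiv ℝ (φ n) y e‖ₑ ∂μ
      ≤ ∫⁻ y in s, ∑ i, ‖e i‖ₑ * ‖pd i (φ n) y‖ₑ ∂μ :=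
        lintegral_mono fun y => enorm_fderiv_le_sum_pd (φ n) y e
    _ = ∑ i, ‖e i‖ₑ * ∫⁻ y in s, ‖pd i (φ n) y‖ₑ ∂μ := by
        rw [lintegral_finsetSum _ fun i _ => (hcont n i).enorm.measurable.const_mul _]
        exact Finset.sum_congr rfl fun i _ => lintegral_const_mul _ (hcont n i).enorm.measurable

lemma IsLipschitzChart.tendsto_lintegral_surf_ball {x e : E d} {h : E d → ℝ} {K : NNReal} {r : ℝ}
    (hc : IsLipschitzChart Ω x e h K r) {F : Type*} [NormedAddCommGroup F] [NormedSpace ℝ F]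
    [CompleteSpace F] {p : ℝ≥0∞} (hp : 1 ≤ p) {ι : Type*} {l : Filter ι} {φ : ι → E d → F}
    (hφ : ∀ n, ContDiff ℝ ∞ (φ n))
    (hlim : Tendsto (fun n => eLpNorm (φ n) p (volume.restrict Ω)) l (𝓝 0))
    (hlim' : ∀ i, Tendsto (fun n => eLpNorm (pd i (φ n)) p (volume.restrict Ω)) l (𝓝 0)) :
    Tendsto (fun n => ∫⁻ y in ball x (r / 2), ‖φ n y‖ₑ ∂surf Ω) l (𝓝 0) := by
  have hfin : (volume : Measure (E d)).restrict Ω (ball x r) ≠ ⊤ :=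
    ((Measure.restrict_apply_le Ω _).trans_lt measure_ball_lt_top).ne
  have hbound := ENNReal.Tendsto.const_mul
    ((tendsto_setLIntegral_enorm_of_tendsto_eLpNorm hp hfin
      (fun n => (hφ n).continuous.aestronglyMeasurable) hlim).add
    (ENNReal.Tendsto.const_mul (tendsto_setLIntegral_enorm_fderiv hp hfin hφ hlim' e)
      (Or.inr (ENNReal.ofReal_ne_top (r := r / 2)))))
    (Or.inr (ENNReal.pow_ne_top (n := d - 1) (ENNReal.coe_ne_top (r := 1 + K))))
  have hδ : ENNReal.ofReal (r / 2) ≠ 0 := (ENNReal.ofReal_pos.2 (half_pos hc.pos)).ne'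
  have hscaled : Tendsto (fun n => ENNReal.ofReal (r / 2) *
      ∫⁻ y in ball x (r / 2), ‖φ n y‖ₑ ∂surf Ω) l (𝓝 0) := by
    rw [mul_zero, add_zero, mul_zero] at hbound
    refine tendsto_of_tendsto_of_tendsto_of_le_of_le tendsto_const_nhds hbound
      (fun _ => zero_le) fun n => ?_
    have hle := hc.mul_lintegral_frontier_le ((hφ n).of_le (by simp))
    rw [finrank_euclideanSpace_fin] at hle
    simp only [surf, Measure.restrict_restrict measurableSet_ball, inter_comm _ Ω]
    exact hle
  simpa [← mul_assoc, ENNReal.inv_mul_cancel hδ ENNReal.ofReal_ne_top] using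
    ENNReal.Tendsto.const_mul hscaled (Or.inr (ENNReal.inv_ne_top.2 hδ))

lemma ae_eq_zero_of_tendsto_lintegral_enorm {X F : Type*} [MeasurableSpace X]
    [NormedAddCommGroup F] {μ : Measure X} {ι : Type*} {l : Filter ι} [l.NeBot] {f : ι → X → F}
    {g : X → F} (hf : ∀ n, AEStronglyMeasurable (f n) μ) (hg : AEStronglyMeasurable g μ)
    (hlim : Tendsto (fun n => ∫⁻ x, ‖f n x‖ₑ ∂μ) l (𝓝 0))
    (hlim' : Tendsto (fun n => ∫⁻ x, ‖f n x - g x‖ₑ ∂μ) l (𝓝 0)) : g =ᵐ[μ] 0 := by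
  have hint : ∫⁻ x, ‖g x‖ₑ ∂μ = 0 := by
    refine le_antisymm (ge_of_tendsto' (add_zero (0 : ℝ≥0∞) ▸ hlim.add hlim') fun n => ?_) zero_le
    rw [← lintegral_add_left' (hf n).enorm]
    refine lintegral_mono fun x => ?_
    simpa using enorm_sub_le (a := f n x) (b := f n x - g x)
  rw [lintegral_eq_zero_iff' hg.enorm] at hint
  filter_upwards [hint] with x hx
  simpa using hx

lemma eLpNorm_sub_coe_zero {X F : Type*} [MeasurableSpace X] [NormedAddCommGroup F]
    {μ : Measure X} {p : ℝ≥0∞} (f : X → F) : eLpNorm (f - ⇑(0 : Lp F p μ)) p μ = eLpNorm f p μ := by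
  refine eLpNorm_congr_ae ?_
  filter_upwards [Lp.coeFn_zero F p μ] with x hx
  rw [Pi.sub_apply, hx, Pi.zero_apply, sub_zero]

lemma HasLipschitzBoundary.traceGraph_unique (hL : HasLipschitzBoundary Ω) {p : L2 Ω × L2bd Ω}
    (hp : p ∈ traceGraph Ω) (hp₀ : p.1 = 0) : p.2 = 0 := by
  obtain ⟨u, g⟩ := p
  obtain rfl : u = 0 := hp₀
  obtain ⟨hu, φ, hφ, ⟨hφ₀, hφ₁⟩, hφg⟩ := hp
  have hD (i) : D Ω i ⟨((0 : L2 Ω), g).1, hu⟩ = 0 := map_zero (D Ω i)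
  simp only [hD, eLpNorm_sub_coe_zero] at hφ₀ hφ₁
  have hcont (n) : AEStronglyMeasurable (φ n) (surf Ω) := (hφ n).continuous.aestronglyMeasurable
  have hg := Lp.aestronglyMeasurable g
  have hball {x e : E d} {h K r} (hc : IsLipschitzChart Ω x e h K r) :
      ∀ᵐ y ∂(surf Ω).restrict (ball x (r / 2)), g y = 0 := by
    have hfin : surf Ω (ball x (r / 2)) ≠ ⊤ := ((measure_mono
      (ball_subset_ball (half_le_self hc.pos.le))).trans_lt hc.surf_ball_lt_top).ne
    exact ae_eq_zero_of_tendsto_lintegral_enorm (fun n => (hcont n).restrict) hg.restrict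
      (hc.tendsto_lintegral_surf_ball one_le_two hφ hφ₀ hφ₁)
      (tendsto_setLIntegral_enorm_of_tendsto_eLpNorm one_le_two hfin
        (fun n => (hcont n).sub hg) hφg)
  rw [Lp.eq_zero_iff_ae_eq_zero]
  change surf Ω {y | g y = 0}ᶜ = 0
  rw [surf_apply, ← inter_self (frontier Ω), ← inter_assoc, ← surf_apply]
  refine measure_null_of_locally_null _ fun x hx => ?_
  obtain ⟨e, h, K, r, hc⟩ := hL.exists_isLipschitzChart hx.2
  refine ⟨{y | g y = 0}ᶜ ∩ ball x (r / 2), ?_, ?_⟩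
  · filter_upwards [self_mem_nhdsWithin,
      mem_nhdsWithin_of_mem_nhds (ball_mem_nhds x (half_pos hc.pos))] with y hy hy'
    exact ⟨hy.1, hy'⟩
  · rw [← Measure.restrict_apply' measurableSet_ball]
    exact hball hc

end Trace

/-! ### Traces of smooth functions -/

section SmoothTrace

variable {d : ℕ} {Ω Γ₀ Γ₁ : Set (E d)}

lemma toLinearPMap_apply_eq {R V W : Type*} [Ring R] [AddCommGroup V] [Module R V]
    [AddCommGroup W] [Module R W] {g : Submodule R (V × W)} (hg : ∀ p ∈ g, p.1 = 0 → p.2 = 0)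
    {x : V} {y : W} (hxy : (x, y) ∈ g) (hx : x ∈ g.toLinearPMap.domain) :
    g.toLinearPMap ⟨x, hx⟩ = y :=
  sub_eq_zero.1 (hg _ (g.sub_mem (Submodule.mem_graph_toLinearPMap hg ⟨x, hx⟩) hxy) (sub_self x))

lemma IsTest.setIntegral_smul_eq_integral {ψ : E d → ℝ} (hψ : IsTest Ω ψ) {F : Type*}
    [NormedAddCommGroup F] [NormedSpace ℝ F] {u φ : E d → F} (hu : u =ᵐ[volume.restrict Ω] φ) :
    ∫ x in Ω, ψ x • u x = ∫ x, ψ x • φ x := by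
  have hcongr : ∫ x in Ω, ψ x • u x = ∫ x in Ω, ψ x • φ x := by
    refine integral_congr_ae ?_
    filter_upwards [hu] with x hx
    rw [hx]
  rw [hcongr]
  refine setIntegral_eq_integral_of_forall_compl_eq_zero fun x hx => ?_
  rw [image_eq_zero_of_notMem_tsupport fun hx' => hx (hψ.subset hx'), zero_smul]

lemma mem_weakPartialGraph_of_contDiff {φ : E d → ℂ} (hφ : ContDiff ℝ 1 φ) {u v : L2 Ω}
    {i : Fin d} (hu : u =ᵐ[volume.restrict Ω] φ) (hv : v =ᵐ[volume.restrict Ω] pd i φ) :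
    (u, v) ∈ weakPartialGraph Ω i := by
  intro θ hθ
  have hint {ψ : E d → ℝ} {χ : E d → ℂ} (hψ : IsTest Ω ψ) (hχ : Continuous χ) :
      Integrable (fun x => ψ x • χ x) :=
    (hψ.smooth.continuous.smul hχ).integrable_of_hasCompactSupport hψ.compact.smul_right
  have hpd : Continuous (pd i φ) := (hφ.continuous_fderiv one_ne_zero).clm_apply continuous_const
  have hparts := integral_smul_fderiv_eq_neg_fderiv_smul_of_integrable
    (hint (hθ.pd i) hφ.continuous) (hint hθ hpd) (hint hθ hφ.continuous)
    (fun x _ => hθ.smooth.differentiable (by simp) x)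
    (fun x _ => hφ.differentiable one_ne_zero x)
  rw [(hθ.pd i).setIntegral_smul_eq_integral hu, hθ.setIntegral_smul_eq_integral hv]
  exact (neg_eq_iff_eq_neg.2 hparts).symm

lemma exists_mem_H1_D_eq (hΩ : IsOpen Ω) {u : L2 Ω} {v : Fin d → L2 Ω}
    (huv : ∀ i, (u, v i) ∈ weakPartialGraph Ω i) : ∃ hu : u ∈ H1 Ω, ∀ i, D Ω i ⟨u, hu⟩ = v i := by
  have hu : u ∈ H1 Ω := (Submodule.mem_iInf _).2 fun i => Submodule.mem_map.2 ⟨_, huv i, rfl⟩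
  exact ⟨hu, fun i => toLinearPMap_apply_eq (weakPartialGraph_unique hΩ i) (huv i) _⟩

lemma mem_traceGraph_of_contDiff (hΩ : IsOpen Ω) {φ : E d → ℂ} (hφ : ContDiff ℝ ∞ φ)
    (hpd : ∀ i, MemLp (pd i φ) 2 (volume.restrict Ω)) {u : L2 Ω} {g : L2bd Ω}
    (hu : u =ᵐ[volume.restrict Ω] φ) (hg : g =ᵐ[surf Ω] φ) : (u, g) ∈ traceGraph Ω := by
  obtain ⟨hu₁, hD⟩ := exists_mem_H1_D_eq hΩ fun i =>
    mem_weakPartialGraph_of_contDiff (hφ.of_le (by simp)) hu (hpd i).coeFn_toLp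
  have hconst {μ : Measure (E d)} {f : E d → ℂ} {w : Lp ℂ 2 μ} (hw : w =ᵐ[μ] f) :
      Tendsto (fun _ : ℕ => eLpNorm (f - ⇑w) 2 μ) atTop (𝓝 0) := by
    rw [eLpNorm_congr_ae (hw.symm.sub_eq), eLpNorm_zero]
    exact tendsto_const_nhds
  exact ⟨hu₁, fun _ => φ, fun _ => hφ,
    ⟨hconst hu, fun i => hD i ▸ hconst (hpd i).coeFn_toLp⟩, hconst hg⟩

lemma HasLipschitzBoundary.exists_trace_ae_eq (hL : HasLipschitzBoundary Ω) {φ : E d → ℂ}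
    (hφ : ContDiff ℝ ∞ φ) (hs : HasCompactSupport φ) :
    ∃ (u : L2 Ω) (_ : u ∈ H1 Ω) (hu : u ∈ (trace Ω).domain), trace Ω ⟨u, hu⟩ =ᵐ[surf Ω] φ := by
  have := hL.isLocallyFiniteMeasure_surf
  have hu : MemLp φ 2 (volume.restrict Ω) := hφ.continuous.memLp_of_hasCompactSupport hs
  have hg : MemLp φ 2 (surf Ω) := hφ.continuous.memLp_of_hasCompactSupport hs
  have hpd (i) : MemLp (pd i φ) 2 (volume.restrict Ω) :=
    (contDiff_pd i hφ).continuous.memLp_of_hasCompactSupport (hs.fderiv_apply (𝕜 := ℝ) _)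
  have hmem := mem_traceGraph_of_contDiff hL.isOpen hφ hpd hu.coeFn_toLp hg.coeFn_toLp
  have hdom : hu.toLp ∈ (trace Ω).domain := Submodule.mem_map.2 ⟨_, hmem, rfl⟩
  have htr : trace Ω ⟨hu.toLp, hdom⟩ = hg.toLp :=
    toLinearPMap_apply_eq (fun _ => hL.traceGraph_unique) hmem hdom
  exact ⟨hu.toLp, hmem.choose, hdom, htr ▸ hg.coeFn_toLp⟩

lemma HasLipschitzBoundary.exists_traceΓ₀_ae_eq (hL : HasLipschitzBoundary Ω) {φ : E d → ℂ}
    (hφ : ContDiff ℝ ∞ φ) (hs : HasCompactSupport φ) (hφ₀ : Disjoint (tsupport φ) Γ₀) :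
    ∃ u : H1Γ₀ Ω Γ₀, traceΓ₀ Ω Γ₀ u =ᵐ[surf Ω] φ := by
  obtain ⟨u, hu, hu', htr⟩ := hL.exists_trace_ae_eq hφ hs
  refine ⟨⟨u, hu, hu', ?_⟩, htr⟩
  have hcompl : ∀ᵐ y ∂(surf Ω).restrict Γ₀, y ∈ (tsupport φ)ᶜ :=
    ae_mono (Measure.restrict_mono_set _ hφ₀.subset_compl_left)
      (ae_restrict_mem (isClosed_tsupport φ).measurableSet.compl)
  filter_upwards [ae_restrict_of_ae htr, hcompl] with y hy hy'
  rw [hy, image_eq_zero_of_notMem_tsupport hy', Pi.zero_apply]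

lemma HasLipschitzBoundary.exists_traceΓ₀_ne_zero (hL : HasLipschitzBoundary Ω) {x : E d}
    (hx : x ∈ frontier Ω) (hx₀ : x ∉ closure Γ₀) (hx₁ : Γ₁ ∈ 𝓝[frontier Ω] x) :
    ∃ u : H1Γ₀ Ω Γ₀, ¬ traceΓ₀ Ω Γ₀ u =ᵐ[(surf Ω).restrict Γ₁] 0 := by
  obtain ⟨ψ, hsub, hs, hψ, -, hψx⟩ :=
    exists_contDiff_tsupport_subset (n := ⊤) (isClosed_closure.isOpen_compl.mem_nhds hx₀)
  have hφ : ContDiff ℝ ∞ fun y => (ψ y : ℂ) := Complex.ofRealCLM.contDiff.comp hψ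
  have hsub' : tsupport (fun y => (ψ y : ℂ)) ⊆ tsupport ψ :=
    closure_mono fun y hy => by simpa using hy
  obtain ⟨u, hu⟩ := hL.exists_traceΓ₀_ae_eq (Γ₀ := Γ₀) hφ (hs.comp_left Complex.ofReal_zero)
    (disjoint_left.2 fun y hy hy₀ => hsub (hsub' hy) (subset_closure hy₀))
  refine ⟨u, fun hzero => ?_⟩
  obtain ⟨O, hO, hxO, hOΓ⟩ := mem_nhdsWithin.1 hx₁
  have hψ₀ : ∀ᵐ y ∂(surf Ω).restrict (O ∩ frontier Ω), ψ y = 0 := by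
    refine ae_mono (Measure.restrict_mono_set _ hOΓ) ?_
    filter_upwards [ae_restrict_of_ae hu, hzero] with y hy hy₀
    simpa using hy.symm.trans hy₀
  have hnull : surf Ω ({y | ψ y ≠ 0} ∩ O) = 0 := by
    have hms : MeasurableSet (O ∩ frontier Ω) :=
      hO.measurableSet.inter isClosed_frontier.measurableSet
    rw [ae_iff, Measure.restrict_apply' hms, surf_apply, inter_assoc, inter_assoc, inter_self]
      at hψ₀
    rwa [surf_apply, inter_assoc]
  have hnhds : {y | ψ y ≠ 0} ∩ O ∈ 𝓝 x :=
    inter_mem (hψ.continuous.continuousAt.eventually_ne (by simp [hψx])) (hO.mem_nhds hxO)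
  exact (hL.surf_pos hx hnhds).ne' hnull

end SmoothTrace

/-! ### Failure of surjectivity -/

lemma not_integrable_norm_rpow {V : Type*} [NormedAddCommGroup V] [NormedSpace ℝ V]
    [FiniteDimensional ℝ V] [Nontrivial V] [MeasurableSpace V] [BorelSpace V] (μ : Measure V)
    [μ.IsAddHaarMeasure] (s : ℝ) : ¬ Integrable (fun ξ => ‖ξ‖ ^ s) μ := by
  rw [integrable_fun_norm_addHaar μ (f := fun r => r ^ s)]
  refine fun hint => not_integrableOn_Ioi_rpow ((finrank ℝ V - 1 : ℕ) + s)
    (hint.congr_fun (fun r hr => ?_) measurableSet_Ioi)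
  change r ^ (finrank ℝ V - 1) * r ^ s = _
  rw [Real.rpow_add hr, Real.rpow_natCast]

lemma ae_eq_zero_of_integrable_prod_mul {X Y 𝕜 : Type*} [MeasurableSpace X] [MeasurableSpace Y]
    [NormedField 𝕜] {μ : Measure X} {ν : Measure Y} [SFinite μ] [SFinite ν] {f : Y → 𝕜}
    {g : X → 𝕜} (hf : ¬ Integrable f ν)
    (hfg : Integrable (fun p : X × Y => f p.2 * g p.1) (μ.prod ν)) : g =ᵐ[μ] 0 := by
  filter_upwards [hfg.prod_right_ae] with x hx
  by_contra hgx
  exact hf ((integrable_mul_const_iff (IsUnit.mk0 _ hgx) f).1 hx)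

lemma not_memLp_norm_rpow_mul {X V : Type*} [MeasurableSpace X] [NormedAddCommGroup V]
    [NormedSpace ℝ V] [FiniteDimensional ℝ V] [Nontrivial V] [MeasurableSpace V] [BorelSpace V]
    {μ : Measure X} [SFinite μ] (ν : Measure V) [ν.IsAddHaarMeasure] {q : ℝ≥0∞} (hq₀ : q ≠ 0)
    (hq : q ≠ ⊤) (s : ℝ) {τ : X → ℂ} (hτ : ¬ τ =ᵐ[μ] 0) :
    ¬ MemLp (fun p : X × V => ((‖p.2‖ ^ s : ℝ) : ℂ) * τ p.1) q (μ.prod ν) := fun hmem => by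
  have hint : Integrable (fun p : X × V => ‖p.2‖ ^ (s * q.toReal) * ‖τ p.1‖ ^ q.toReal)
      (μ.prod ν) := by
    refine (hmem.integrable_norm_rpow hq₀ hq).congr (.of_forall fun p => ?_)
    dsimp only
    rw [norm_mul, Complex.norm_real, Real.norm_of_nonneg (by positivity),
      Real.mul_rpow (by positivity) (norm_nonneg _), ← Real.rpow_mul (norm_nonneg _)]
  refine hτ ?_
  filter_upwards [ae_eq_zero_of_integrable_prod_mul (g := fun x => ‖τ x‖ ^ q.toReal)
    (not_integrable_norm_rpow ν _) hint] with x hx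
  have hq' : q.toReal ≠ 0 := ENNReal.toReal_ne_zero.2 ⟨hq₀, hq⟩
  exact norm_eq_zero.1 ((Real.rpow_eq_zero (norm_nonneg _) hq').1 hx)

section Operator

variable {d : ℕ} {Ω Γ₀ Γ₁ : Set (E d)}

lemma mu_eq_rpow_mul_sq (α : ℝ) {ξ : E d} (hξ : ξ ≠ 0) :
    mu α ξ = ‖ξ‖ ^ ((2 * α - d - 4) / 2) * ‖ξ‖ ^ 2 := by
  rw [mu, ← Real.rpow_natCast, ← Real.rpow_add (norm_pos_iff.2 hξ)]
  congr 1
  push_cast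
  ring

lemma eq_rpow_mul_of_auxFun_eq_zero {α : ℝ} {τ : L2bd Ω} {w : L2aux Ω Γ₁} {p : E d × E d}
    (hp : p.2 ≠ 0) (h : auxFun 0 α τ w p = 0) :
    w p = ((‖p.2‖ ^ ((2 * α - d - 4) / 2) : ℝ) : ℂ) * τ p.1 := by
  have hne : ((‖p.2‖ ^ 2 : ℝ) : ℂ) ≠ 0 := by simpa using hp
  rw [auxFun, mu_eq_rpow_mul_sq α hp, add_zero] at h
  refine mul_left_cancel₀ hne ?_
  push_cast at h ⊢
  linear_combination -h

lemma memLp_of_auxFun_ae_eq_zero [Nontrivial (E d)] {α : ℝ} {τ : L2bd Ω} {w : L2aux Ω Γ₁}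
    (h : auxFun 0 α τ w =ᵐ[surfProd Ω Γ₁] 0) :
    MemLp (fun p : E d × E d => ((‖p.2‖ ^ ((2 * α - d - 4) / 2) : ℝ) : ℂ) * τ p.1) 2
      (surfProd Ω Γ₁) := by
  have hne : ∀ᵐ p ∂surfProd Ω Γ₁, p.2 ≠ 0 :=
    Measure.quasiMeasurePreserving_snd.ae (Measure.ae_ne volume 0)
  refine (Lp.memLp w).ae_eq ?_
  filter_upwards [h, hne] with p hp hp₀
  exact eq_rpow_mul_of_auxFun_eq_zero hp₀ hp

lemma auxFun_ae_eq_zero_of_neg_opA_eq {a b γ α η : ℝ} {φ : H1Γ₀ Ω Γ₀}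
    {U : (-(opA Ω Γ₀ Γ₁ a b γ α η)).domain}
    (hU : (-(opA Ω Γ₀ Γ₁ a b γ α η)) U = (φ, 0, 0, 0, 0)) :
    auxFun η α (traceΓ₀ Ω Γ₀ (-φ)) U.1.2.2.2.2 =ᵐ[surfProd Ω Γ₁] 0 := by
  obtain ⟨U, hdom⟩ := U
  change U ∈ domA Ω Γ₀ Γ₁ γ α η at hdom
  rw [LinearPMap.neg_apply, neg_eq_iff_eq_neg] at hU
  have hv : (⟨U.2.1, domA_v hdom⟩ : H1Γ₀ Ω Γ₀) = -φ := congrArg Prod.fst hU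
  have hw : (domA_w hdom).toLp = -(0 : L2aux Ω Γ₁) := congrArg (fun V => V.2.2.2.2) hU
  rw [← hv]
  refine (domA_w hdom).coeFn_toLp.symm.trans ?_
  rw [hw, neg_zero]
  exact Lp.coeFn_zero ℂ 2 (surfProd Ω Γ₁)

lemma memLp_of_neg_opA_eq [Nontrivial (E d)] {a b γ α : ℝ} {φ : H1Γ₀ Ω Γ₀}
    {U : (-(opA Ω Γ₀ Γ₁ a b γ α 0)).domain}
    (hU : (-(opA Ω Γ₀ Γ₁ a b γ α 0)) U = (φ, 0, 0, 0, 0)) :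
    MemLp (fun p : E d × E d =>
      ((‖p.2‖ ^ ((2 * α - d - 4) / 2) : ℝ) : ℂ) * traceΓ₀ Ω Γ₀ φ p.1) 2 (surfProd Ω Γ₁) := by
  have hneg : ∀ᵐ p ∂surfProd Ω Γ₁, traceΓ₀ Ω Γ₀ (-φ) p.1 = -traceΓ₀ Ω Γ₀ φ p.1 := by
    rw [map_neg]
    exact Measure.quasiMeasurePreserving_fst.ae (ae_restrict_of_ae (Lp.coeFn_neg _))
  refine (memLp_of_auxFun_ae_eq_zero (auxFun_ae_eq_zero_of_neg_opA_eq hU)).neg.ae_eq ?_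
  filter_upwards [hneg] with p hp
  rw [Pi.neg_apply, hp, mul_neg, neg_neg]

lemma zero_mem_spectrumOf_iff {H : Type*} [AddCommGroup H] [Module ℂ H] {N : H → ℝ}
    {T : H →ₗ.[ℂ] H} : (0 : ℂ) ∈ spectrumOf N T ↔ ¬ IsInvertible N (-T) := by
  rw [spectrumOf, mem_ofPred_eq, shift, zero_smul, zero_vadd]

lemma nontrivial_of_mem_frontier {X : Type*} [TopologicalSpace X] {s : Set X} {x : X}
    (hx : x ∈ frontier s) : Nontrivial X := by
  by_contra h
  rw [not_nontrivial_iff_subsingleton] at h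
  simp at hx

lemma IsAdmissible.exists_mem_frontier (hΩ : IsAdmissible Ω Γ₀ Γ₁) :
    ∃ x ∈ frontier Ω, x ∉ closure Γ₀ ∧ Γ₁ ∈ 𝓝[frontier Ω] x := by
  obtain ⟨x, hx⟩ := hΩ.nonempty₁
  obtain ⟨O, hO, rfl⟩ := hΩ.relOpen₁
  exact ⟨x, hx.2, disjoint_right.1 hΩ.disjoint (subset_closure hx),
    inter_comm _ O ▸ inter_mem_nhdsWithin _ (hO.mem_nhds hx.1)⟩

end Operator

end CoupledWave

open CoupledWave in
theorem mainTheorem4_general {d : ℕ} {Ω Γ₀ Γ₁ : Set (E d)} (hL : HasLipschitzBoundary Ω) {x : E d}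
    (hx : x ∈ frontier Ω) (hx₀ : x ∉ closure Γ₀) (hx₁ : Γ₁ ∈ 𝓝[frontier Ω] x) (a b γ α : ℝ)
    (N : EnergySpace Ω Γ₀ Γ₁ → ℝ) :
    ¬ IsInvertible N (-(opA Ω Γ₀ Γ₁ a b γ α 0)) ∧
    (0 : ℂ) ∈ spectrumOf N (opA Ω Γ₀ Γ₁ a b γ α 0) ∧
    (∃ φ : H1Γ₀ Ω Γ₀, ¬ traceΓ₀ Ω Γ₀ φ =ᵐ[(surf Ω).restrict Γ₁] 0) ∧
    (∀ φ : H1Γ₀ Ω Γ₀, ¬ traceΓ₀ Ω Γ₀ φ =ᵐ[(surf Ω).restrict Γ₁] 0 →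
      ¬ MemLp (fun p : E d × E d =>
          ((‖p.2‖ ^ ((2 * α - d - 4) / 2) : ℝ) : ℂ) * traceΓ₀ Ω Γ₀ φ p.1) 2 (surfProd Ω Γ₁) ∧
      ¬ ∃ U : (-(opA Ω Γ₀ Γ₁ a b γ α 0)).domain,
        (-(opA Ω Γ₀ Γ₁ a b γ α 0)) U = (φ, 0, 0, 0, 0)) := by
  have := nontrivial_of_mem_frontier hx
  have := hL.isLocallyFiniteMeasure_surf
  have hL2 (φ : H1Γ₀ Ω Γ₀) (hφ : ¬ traceΓ₀ Ω Γ₀ φ =ᵐ[(surf Ω).restrict Γ₁] 0) :=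
    not_memLp_norm_rpow_mul (V := E d) volume two_ne_zero ENNReal.ofNat_ne_top
      ((2 * α - d - 4) / 2) hφ
  obtain ⟨φ, hφ⟩ := hL.exists_traceΓ₀_ne_zero hx hx₀ hx₁
  have hinv : ¬ IsInvertible N (-(opA Ω Γ₀ Γ₁ a b γ α 0)) := fun h =>
    let ⟨_, hU⟩ := h.1.2 (φ, 0, 0, 0, 0)
    hL2 φ hφ (memLp_of_neg_opA_eq hU)
  exact ⟨hinv, zero_mem_spectrumOf_iff.2 hinv, ⟨φ, hφ⟩, fun ψ hψ =>
    ⟨hL2 ψ hψ, fun ⟨_, hU⟩ => hL2 ψ hψ (memLp_of_neg_opA_eq hU)⟩⟩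

theorem mainTheorem4 {d : ℕ} (hd : 2 ≤ d) (Ω Γ₀ Γ₁ : Set (CoupledWave.E d))
    (hΩ : CoupledWave.IsAdmissible Ω Γ₀ Γ₁)
    (a b γ α η : ℝ) (ha : 0 < a) (hb : b ≠ 0) (hγ : 0 < γ) (hα₀ : 0 < α) (hα₁ : α < 1)
    (hη : η = 0) :
    ¬ CoupledWave.IsInvertible (CoupledWave.energyNorm Ω Γ₀ Γ₁ a γ α)
        (-(CoupledWave.opA Ω Γ₀ Γ₁ a b γ α η)) ∧
    (0 : ℂ) ∈ CoupledWave.spectrumOf (CoupledWave.energyNorm Ω Γ₀ Γ₁ a γ α)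
        (CoupledWave.opA Ω Γ₀ Γ₁ a b γ α η) ∧
    (∃ φ : CoupledWave.H1Γ₀ Ω Γ₀,
      ¬ (CoupledWave.traceΓ₀ Ω Γ₀ φ =ᵐ[(CoupledWave.surf Ω).restrict Γ₁] 0)) ∧
    (∀ φ : CoupledWave.H1Γ₀ Ω Γ₀,
      ¬ (CoupledWave.traceΓ₀ Ω Γ₀ φ =ᵐ[(CoupledWave.surf Ω).restrict Γ₁] 0) →
        ¬ MemLp (fun p : CoupledWave.E d × CoupledWave.E d =>
            ((‖p.2‖ ^ ((2 * α - d - 4) / 2) : ℝ) : ℂ) * CoupledWave.traceΓ₀ Ω Γ₀ φ p.1)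
          2 (CoupledWave.surfProd Ω Γ₁) ∧
        ¬ ∃ U : (-(CoupledWave.opA Ω Γ₀ Γ₁ a b γ α η)).domain,
          (-(CoupledWave.opA Ω Γ₀ Γ₁ a b γ α η)) U = (φ, 0, 0, 0, 0)) := by
  subst hη
  obtain ⟨x, hx, hx₀, hx₁⟩ := hΩ.exists_mem_frontier
  exact mainTheorem4_general hΩ.lipschitz hx hx₀ hx₁ a b γ α _
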